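/- For $n\ge 0$ the quantum incrementor on $n$ qubits is the unitary $|x\rangle\mapsto|(x+1)\bmod 2^n\rangle$, $0\le x<2^n$, where $|x\rangle$ is the computational basis state given by the $n$ binary digits of $x$. There is a family of quantum circuits $(C_n)_{n\ge 0}$, where $C_n$ acts on $n+1$ qubits and consists only of CNOT gates and arbitrary single-qubit unitary gates (the gate set $\mathcal{B}_2$), such that $C_n$ implements the incrementor on $n$ qubits exactly, using one clean ancillary qubit: for every $n$-qubit state $|\psi\rangle$, $C_n$ maps $|\psi\rangle|0\rangle$ to $(U_n|\psi\rangle)|0\rangle$, where $U_n$ is the incrementor. Moreover, as $n\to\infty$, the depth of $C_n$ is $O(\log^2 n)$ and the size (number of gates) of $C_n$ is $O(n)$. -/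

import Mathlib

open Filter Asymptotics

namespace QCircuit

/-- Labels of the computational basis of a register whose qubits are labelled by `Q`. -/
abbrev Bits (Q : Type) : Type := Q → Fin 2

/-- Vectors of the state space `(ℂ²)^{⊗ Q}`, written in the computational basis. -/
abbrev State (Q : Type) : Type := Bits Q → ℂ

/-- Gates over the gate set of all single-qubit unitaries together with CNOT, placed on
qubits of a register `Q`. -/
inductive Gate (Q : Type) : Type where
  | single (U : Matrix.unitaryGroup (Fin 2) ℂ) (q : Q) : Gate Q
  | cnot (control target : Q) (h : control ≠ target) : Gate Q

variable {Q : Type} [Fintype Q] [DecidableEq Q]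

/-- The set of qubits a gate acts on. -/
def Gate.support : Gate Q → Finset Q
  | .single _ q => {q}
  | .cnot c t _ => {c, t}

/-- The operator of a gate on the whole register: a single-qubit gate `U` on `q` acts as `U` on
qubit `q` and as the identity elsewhere, and CNOT adds the control bit to the target bit
modulo 2. Rows are output basis labels, columns are input basis labels. -/
def Gate.toMatrix : Gate Q → Matrix (Bits Q) (Bits Q) ℂ
  | .single U q => Matrix.of fun y x =>
      if ∀ r, r ≠ q → y r = x r then (U : Matrix (Fin 2) (Fin 2) ℂ) (y q) (x q) else 0
  | .cnot c t _ => Matrix.of fun y x =>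
      if y = Function.update x t (x t + x c) then 1 else 0

/-- A quantum circuit: a sequence of gates, the head of the list being applied first. -/
abbrev Circuit (Q : Type) : Type := List (Gate Q)

/-- The operator computed by a circuit. -/
def Circuit.toMatrix : Circuit Q → Matrix (Bits Q) (Bits Q) ℂ
  | [] => 1
  | g :: C => Circuit.toMatrix C * g.toMatrix

/-- The size of a circuit is its number of gates. -/
def Circuit.size (C : Circuit Q) : ℕ := List.length C

/-- The number of gates on a longest directed path of the circuit that enters on the input
wire of the qubit `q`. -/
def Circuit.depthFrom : Circuit Q → Q → ℕ
  | [], _ => 0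
  | g :: C, q =>
      if q ∈ g.support then 1 + g.support.sup (fun r => Circuit.depthFrom C r)
      else Circuit.depthFrom C q

/-- The depth of a circuit: the number of gates on a longest directed path, which is the least
number of layers of gates with pairwise disjoint supports. -/
def Circuit.depth (C : Circuit Q) : ℕ := Finset.univ.sup fun q => Circuit.depthFrom C q

/-- The state `ψ ⊗ |0…0⟩` of a register `Q` together with ancillary qubits `A`. -/
def withZeros {A : Type} [Fintype A] (ψ : State Q) : State (Q ⊕ A) := fun z =>
  if ∀ a, z (Sum.inr a) = 0 then ψ (fun q => z (Sum.inl q)) else 0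

/-- The circuit `C` implements `V` on the register `Q` exactly, with clean ancillary qubits `A`:
they start in state `|0⟩` and are returned to state `|0⟩`. -/
def Circuit.ImplementsWithCleanAncillas {A : Type} [Fintype A] [DecidableEq A]
    (C : Circuit (Q ⊕ A)) (V : Matrix (Bits Q) (Bits Q) ℂ) : Prop :=
  ∀ ψ : State Q,
    (Circuit.toMatrix C).mulVec (withZeros (A := A) ψ) = withZeros (A := A) (V.mulVec ψ)

/-- The number whose binary digits are `x`, with `x 0` the least significant one. -/
def value {n : ℕ} (x : Bits (Fin n)) : ℕ := ∑ i, (x i : ℕ) * 2 ^ (i : ℕ)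

/-- The quantum incrementor `|x⟩ ↦ |x + 1 mod 2^n⟩`. -/
def incrementor (n : ℕ) : Matrix (Bits (Fin n)) (Bits (Fin n)) ℂ :=
  Matrix.of fun y x => if value y = (value x + 1) % 2 ^ n then 1 else 0

end QCircuit

/-! Everything takes place in classical reversible circuits of NOT, CNOT and Toffoli gates. Each of
these costs at most 17 gates of the given set, so depth and size change by a constant factor only.

The scarce resource is clean workspace. The register is incremented in blocks, low digits first.
Suppose that some wires are clean whenever the control bits `L` are all 1. One clean wire `s`
receives the conjunction of the next block `B`, and `B` is complemented. If a carry leaves `B`, then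
`B` consisted of ones, so it is now all zeros. Hence the higher digits can be incremented under the
controls `s :: L` with `B` as additional workspace, clean exactly in the case that matters.
Afterwards the flag is uncomputed and `B` itself is incremented (`Stage.increments_append`).

A block may be about half as large as the present workspace, so the workspace grows by a factor of
at least 8/7 per stage and O(log n) stages suffice (`exists_increments`). Within a stage a carry
look-ahead tree has depth O(log n), and so has the gate controlled by `L`, since `L` gains one wire
per stage. This gives depth O(log² n). The size is linear in the block plus O(log n) per stage,
hence O(n) in total.

Each circuit must act as the identity when its controls fail, although its workspace is then
arbitrary. Only one gate, a multiply controlled NOT on borrowed wires (`run_multiControl`), reads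
the controls in the tree increment; everything around it cancels if it does not fire
(`run_treeIncrement`). If it fires, the carries must also be erased after the addition. This uses
that the complement of x + 1 produces the same carries as x (`CarryTree.Carried.of_not_ripple`), so
the circuit that loaded them also unloads them. -/

namespace QCircuit

/-! ### Classical reversible gates and the ripple increment -/

section Reversible

variable {Q : Type} [DecidableEq Q]

/-- The conjunction of the bits on the wires `cs`. -/
def conj (σ : Bits Q) : List Q → Fin 2
  | [] => 1
  | c :: cs => σ c * conj σ cs

/-- A classical gate: the target is flipped if all controls are set. -/
structure CX (Q : Type) : Type where
  controls : List Q
  target : Q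

/-- The wires of a classical gate. -/
def CX.wires (g : CX Q) : List Q := g.target :: g.controls

/-- The action of a classical gate. -/
def CX.act (g : CX Q) (σ : Bits Q) : Bits Q :=
  Function.update σ g.target (σ g.target + conj σ g.controls)

/-- The action of a sequence of classical gates, the head being applied first. -/
def run : List (CX Q) → Bits Q → Bits Q
  | [], σ => σ
  | g :: C, σ => run C (g.act σ)

/-- All gates act on distinct wires and have at most two controls. -/
def Valid (C : List (CX Q)) : Prop := ∀ g ∈ C, g.wires.Nodup ∧ g.controls.length ≤ 2

/-- Increment the number with binary digits `xs` (least significant first) by `g`. -/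
def ripple (g : Fin 2) : List Q → Bits Q → Bits Q
  | [], σ => σ
  | x :: xs, σ => Function.update (ripple (g * σ x) xs σ) x (σ x + g)

end Reversible

/-! ### Inversion, locality and layered depth of classical circuits -/

section ReversibleLemmas

theorem fin_two_eq_zero_or_one (a : Fin 2) : a = 0 ∨ a = 1 := by revert a; decide

theorem fin_two_add_add_cancel (a b : Fin 2) : a + b + b = a := by revert a b; decide

variable {Q : Type}

theorem conj_congr {σ τ : Bits Q} {cs : List Q} (h : ∀ q ∈ cs, σ q = τ q) :
    conj σ cs = conj τ cs := by
  induction cs with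
  | nil => rfl
  | cons c cs ih => simp only [conj]; rw [h c (by simp), ih fun q hq => h q (by simp [hq])]

theorem conj_append (σ : Bits Q) (L M : List Q) : conj σ (L ++ M) = conj σ L * conj σ M := by
  induction L with
  | nil => simp [conj]
  | cons c cs ih =>
    simp only [List.cons_append, conj, ih]
    generalize σ c = a; generalize conj σ cs = b; generalize conj σ M = d
    revert a b d; decide

theorem conj_eq_one_iff {σ : Bits Q} {L : List Q} : conj σ L = 1 ↔ ∀ q ∈ L, σ q = 1 := by
  induction L with
  | nil => simp [conj]
  | cons c cs ih =>
    simp only [conj, List.forall_mem_cons, ← ih]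
    generalize σ c = a; generalize conj σ cs = b
    revert a b; decide

theorem Valid.append {A B : List (CX Q)} (hA : Valid A) (hB : Valid B) : Valid (A ++ B) := by
  intro g hg
  rcases List.mem_append.1 hg with h | h
  exacts [hA g h, hB g h]

theorem Valid.reverse {A : List (CX Q)} (hA : Valid A) : Valid A.reverse :=
  fun g hg => hA g (List.mem_reverse.1 hg)

theorem Valid.nil : Valid ([] : List (CX Q)) := by simp [Valid]

theorem Valid.cons {g : CX Q} {A : List (CX Q)} (hg : g.wires.Nodup ∧ g.controls.length ≤ 2)
    (hA : Valid A) : Valid (g :: A) := by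
  simpa [Valid] using ⟨hg, hA⟩

/-- The circuit `C` can be arranged in `d` layers of gates. -/
inductive DepthLE : List (CX Q) → ℕ → Prop
  | nil : DepthLE [] 0
  | gate (g : CX Q) : DepthLE [g] 1
  | seq {A B : List (CX Q)} {a b : ℕ} : DepthLE A a → DepthLE B b → DepthLE (A ++ B) (a + b)
  | par {A B : List (CX Q)} {d : ℕ} : DepthLE A d → DepthLE B d →
      (∀ g ∈ A, ∀ g' ∈ B, ∀ q ∈ g.wires, q ∉ g'.wires) → DepthLE (A ++ B) d
  | mono {A : List (CX Q)} {a b : ℕ} : DepthLE A a → a ≤ b → DepthLE A b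

theorem DepthLE.reverse {A : List (CX Q)} {a : ℕ} (h : DepthLE A a) : DepthLE A.reverse a := by
  induction h with
  | nil => exact .nil
  | gate g => exact .gate g
  | seq _ _ hA hB => simpa [add_comm] using hB.seq hA
  | par _ _ hd hA hB =>
    rw [List.reverse_append]
    refine hB.par hA fun g hg g' hg' q hq hq' => ?_
    exact hd g' (by simpa using hg') g (by simpa using hg) q hq' hq
  | mono _ hab hA => exact hA.mono hab

variable [DecidableEq Q]

theorem run_append (A B : List (CX Q)) (σ : Bits Q) : run (A ++ B) σ = run B (run A σ) := by
  induction A generalizing σ with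
  | nil => rfl
  | cons g A ih => simp [run, ih]

theorem CX.act_act {g : CX Q} (hg : g.wires.Nodup) (σ : Bits Q) : g.act (g.act σ) = σ := by
  have h : conj (g.act σ) g.controls = conj σ g.controls := conj_congr fun q hq => by
    have : q ≠ g.target := by rintro rfl; simp [CX.wires] at hg; exact hg.1 hq
    simp [CX.act, this]
  rw [CX.act, h]
  simp [CX.act, fin_two_add_add_cancel]

theorem run_reverse_run {C : List (CX Q)} (hC : Valid C) (σ : Bits Q) :
    run C.reverse (run C σ) = σ := by
  induction C generalizing σ with
  | nil => rfl
  | cons g C ih =>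
    have h : Valid C := fun g' hg' => hC g' (by simp [hg'])
    simp only [List.reverse_cons, run_append, run, ih h]
    exact CX.act_act (hC g (by simp)).1 σ

theorem run_run_reverse {C : List (CX Q)} (hC : Valid C) (σ : Bits Q) :
    run C (run C.reverse σ) = σ := by
  simpa using run_reverse_run hC.reverse σ

theorem run_apply_of_not_target {C : List (CX Q)} {q : Q} (h : ∀ g ∈ C, g.target ≠ q)
    (σ : Bits Q) : run C σ q = σ q := by
  induction C generalizing σ with
  | nil => rfl
  | cons g C ih =>
    rw [run, ih fun g' hg' => h g' (by simp [hg'])]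
    simp [CX.act, (h g (by simp)).symm]

/-- A circuit on wires in `S` acts on the bits in `S` independently of the others. -/
theorem run_congr {C : List (CX Q)} {S : Set Q} (hC : ∀ g ∈ C, ∀ q ∈ g.wires, q ∈ S)
    {σ τ : Bits Q} (h : ∀ q ∈ S, σ q = τ q) : ∀ q ∈ S, run C σ q = run C τ q := by
  induction C generalizing σ τ with
  | nil => exact h
  | cons g C ih =>
    refine ih (fun g' hg' => hC g' (by simp [hg'])) fun q hq => ?_
    have hw := hC g (by simp)
    simp only [CX.wires, List.forall_mem_cons] at hw
    simp only [CX.act, Function.update_apply]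
    rw [conj_congr (τ := τ) fun q hq => h q (hw.2 q hq), h _ hw.1, h q hq]

theorem ripple_apply_of_notMem {g : Fin 2} {xs : List Q} {q : Q} (h : q ∉ xs) (σ : Bits Q) :
    ripple g xs σ q = σ q := by
  induction xs generalizing g with
  | nil => rfl
  | cons x xs ih =>
    simp only [List.mem_cons, not_or] at h
    simp [ripple, h.1, ih h.2]

theorem ripple_congr {g : Fin 2} {xs : List Q} {σ τ : Bits Q} (h : ∀ q ∈ xs, σ q = τ q)
    {q : Q} (hq : σ q = τ q) : ripple g xs σ q = ripple g xs τ q := by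
  induction xs generalizing g with
  | nil => exact hq
  | cons x xs ih =>
    simp only [ripple, Function.update_apply]
    rw [h x (by simp), ih fun q hq => h q (by simp [hq])]

/-- A carry leaves `B` exactly when one enters and all digits of `B` are 1. This is what allows the
register to be treated block by block. -/
theorem ripple_append {g : Fin 2} {B ys : List Q} (h : ∀ q ∈ B, q ∉ ys) (σ : Bits Q) :
    ripple g (B ++ ys) σ = ripple g B (ripple (g * conj σ B) ys σ) := by
  induction B generalizing g with
  | nil =>
    have : g * 1 = g := by revert g; decide
    simp [ripple, conj, this]
  | cons x B ih =>
    simp only [List.cons_append, ripple, conj]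
    rw [ih fun q hq => h q (by simp [hq]), ripple_apply_of_notMem (h x (by simp))]
    have : ∀ a b c : Fin 2, a * b * c = a * (b * c) := by decide
    rw [this]

theorem ripple_zero (xs : List Q) (σ : Bits Q) : ripple 0 xs σ = σ := by
  induction xs with
  | nil => rfl
  | cons x xs ih =>
    have : (0 : Fin 2) * σ x = 0 := by generalize σ x = a; revert a; decide
    simp [ripple, this, ih]

/-- A circuit disjoint from `xs` commutes with incrementing `xs`. -/
theorem run_ripple {C : List (CX Q)} {xs : List Q} (hC : ∀ g ∈ C, ∀ q ∈ g.wires, q ∉ xs)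
    (g : Fin 2) (σ : Bits Q) : run C (ripple g xs σ) = ripple g xs (run C σ) := by
  have hx : ∀ q ∈ xs, ∀ τ, run C τ q = τ q := fun q hq τ =>
    run_apply_of_not_target (fun g' hg' e => hC g' hg' q (by simp [CX.wires, e]) hq) τ
  funext q
  by_cases hq : q ∈ xs
  · rw [hx q hq]
    exact ripple_congr (fun r hr => (hx r hr σ).symm) (hx q hq σ).symm
  · rw [ripple_apply_of_notMem hq]
    exact run_congr (S := {q | q ∉ xs}) hC (fun r hr => ripple_apply_of_notMem hr σ) q hq

end ReversibleLemmas

/-! ### Multiply controlled NOT with borrowed wires -/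

section Ladder

variable {Q : Type}

theorem DepthLE.length (C : List (CX Q)) : DepthLE C C.length := by
  induction C with
  | nil => exact .nil
  | cons g C ih => simpa [add_comm] using (DepthLE.gate g).seq ih

theorem Valid.of_cons {g : CX Q} {C : List (CX Q)} (h : Valid (g :: C)) : Valid C :=
  fun g' hg' => h g' (by simp [hg'])

/-- A ladder of gates which adds the conjunction of `L` to `t`, and also changes the borrowed
wires `ds`. -/
def ladder : Q → List Q → List Q → List (CX Q)
  | t, [], _ => [⟨[], t⟩]
  | _, _ :: _, [] => []
  | t, l :: ls, d :: ds => ⟨[l, d], t⟩ :: (ladder d ls ds ++ [⟨[l, d], t⟩])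

/-- Adds the conjunction of `L` to `t`, borrowing the wires `ds`. -/
def multiControl (t : Q) : List Q → List Q → List (CX Q)
  | l :: ls, d :: ds => ladder t (l :: ls) (d :: ds) ++ ladder d ls ds
  | L, _ => ladder t L []

/-- The gate list is a palindrome of involutions, so a valid ladder is its own inverse. This is how
borrowed wires get restored. -/
theorem ladder_reverse (t : Q) (L ds : List Q) : (ladder t L ds).reverse = ladder t L ds := by
  induction L generalizing t ds with
  | nil => rfl
  | cons l ls ih =>
    cases ds with
    | nil => rfl
    | cons d ds => simp [ladder, ih]

theorem ladder_valid {t : Q} {L ds : List Q} (h : (t :: (L ++ ds)).Nodup) :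
    Valid (ladder t L ds) := by
  induction L generalizing t ds with
  | nil => exact Valid.cons (by simp [CX.wires]) Valid.nil
  | cons l ls ih =>
    cases ds with
    | nil => exact Valid.nil
    | cons d ds =>
      have hg : (CX.mk [l, d] t).wires.Nodup ∧ (CX.mk [l, d] t).controls.length ≤ 2 := by
        simp [CX.wires] at h ⊢
        grind
      refine Valid.cons hg (Valid.append (ih ?_) (Valid.cons hg Valid.nil))
      simp [List.nodup_append] at h ⊢
      grind

theorem ladder_wires {t : Q} {L ds : List Q} :
    ∀ g ∈ ladder t L ds, ∀ q ∈ g.wires, q = t ∨ q ∈ L ∨ q ∈ ds := by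
  induction L generalizing t ds with
  | nil => simp [ladder, CX.wires]
  | cons l ls ih =>
    cases ds with
    | nil => simp [ladder]
    | cons d ds =>
      intro g hg q hq
      simp only [ladder, List.mem_cons, List.mem_append, List.not_mem_nil, or_false] at hg
      rcases hg with rfl | hg | rfl
      · simp [CX.wires] at hq; grind
      · have := ih g hg q hq; grind
      · simp [CX.wires] at hq; grind

theorem ladder_target {t : Q} {L ds : List Q} :
    ∀ g ∈ ladder t L ds, g.target = t ∨ g.target ∈ ds := by
  induction L generalizing t ds with
  | nil => simp [ladder]
  | cons l ls ih =>
    cases ds with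
    | nil => simp [ladder]
    | cons d ds =>
      intro g hg
      simp only [ladder, List.mem_cons, List.mem_append, List.not_mem_nil, or_false] at hg
      rcases hg with rfl | hg | rfl
      · simp
      · have := ih g hg; grind
      · simp

theorem ladder_length (t : Q) (L ds : List Q) : (ladder t L ds).length ≤ 2 * L.length + 1 := by
  induction L generalizing t ds with
  | nil => simp [ladder]
  | cons l ls ih =>
    cases ds with
    | nil => simp [ladder]
    | cons d ds => have := ih d ds; simp [ladder]; omega

theorem multiControl_length (t : Q) (L ds : List Q) :
    (multiControl t L ds).length ≤ 4 * L.length + 2 := by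
  rcases L with _ | ⟨l, ls⟩
  · simp [multiControl, ladder]
  · rcases ds with _ | ⟨d, ds⟩
    · simp [multiControl, ladder]
    · have := ladder_length t (l :: ls) (d :: ds)
      have := ladder_length d ls ds
      simp [multiControl] at *; omega

theorem multiControl_valid {t : Q} {L ds : List Q} (h : (t :: (L ++ ds)).Nodup) :
    Valid (multiControl t L ds) := by
  rcases L with _ | ⟨l, ls⟩
  · exact ladder_valid (by simp)
  · rcases ds with _ | ⟨d, ds⟩
    · exact ladder_valid (by simpa using h)
    · refine (ladder_valid h).append (ladder_valid ?_)
      simp [List.nodup_append] at h ⊢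
      grind

variable [DecidableEq Q]

/-- The two outer gates add `l` times the old and `l` times the new value of `d` to `t`. Only the
change of `d` survives, so its unknown initial value is irrelevant. Away from `t` only the inner
ladder is felt. -/
theorem ladder_cons_apply {t l d : Q} {ls ds : List Q} (h : (t :: (l :: ls ++ d :: ds)).Nodup)
    (σ : Bits Q) (q : Q) : run (ladder t (l :: ls) (d :: ds)) σ q =
      if q = t then σ t + σ l * (σ d + run (ladder d ls ds) σ d)
      else run (ladder d ls ds) σ q := by
  have ht : ∀ g ∈ ladder d ls ds, ∀ q ∈ g.wires, q ∈ {q | q ≠ t} := by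
    intro g hg q hq
    have := ladder_wires g hg q hq
    simp [List.nodup_append] at h ⊢
    grind
  have hl : ∀ τ, run (ladder d ls ds) τ l = τ l := run_apply_of_not_target fun g hg e => by
    have := ladder_target g hg
    simp [List.nodup_append] at h
    grind
  have hne : d ≠ t ∧ l ≠ t := by simp at h; grind
  have hq : ∀ q, q ≠ t → run (ladder d ls ds) ((CX.mk [l, d] t).act σ) q
      = run (ladder d ls ds) σ q := by
    refine run_congr (S := {q | q ≠ t}) ht fun q hq => ?_
    simp [CX.act, show q ≠ t from hq]
  have hqt : ∀ τ, run (ladder d ls ds) τ t = τ t := run_apply_of_not_target fun g hg e =>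
    ht g hg t (by simp [CX.wires, e]) rfl
  rw [ladder, run, run_append]
  generalize hτ : run (ladder d ls ds) ((CX.mk [l, d] t).act σ) = τ
  simp only [run, CX.act, conj, Function.update_apply]
  by_cases e : q = t
  · subst e
    simp only [if_true]
    rw [← hτ, hqt, hl, hq d hne.1]
    simp only [CX.act, Function.update_apply, conj, hne.2, if_true, if_false]
    generalize σ q = a; generalize σ l = b; generalize σ d = c
    generalize run (ladder d ls ds) σ d = e
    revert a b c e; decide
  · simp only [e, if_false]
    rw [← hτ, hq q e]

theorem ladder_apply {t : Q} {L ds : List Q} (h : (t :: (L ++ ds)).Nodup)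
    (hlen : L.length ≤ ds.length) (σ : Bits Q) :
    run (ladder t L ds) σ t = σ t + conj σ L := by
  induction L generalizing t ds with
  | nil => simp [ladder, run, CX.act, conj]
  | cons l ls ih =>
    cases ds with
    | nil => simp at hlen
    | cons d ds =>
      rw [ladder_cons_apply h, if_pos rfl, ih ?_ (by simpa using hlen)]
      · simp only [conj]
        generalize σ t = a; generalize σ l = b; generalize σ d = c; generalize conj σ ls = e
        revert a b c e; decide
      · simp [List.nodup_append] at h ⊢
        grind

theorem run_multiControl {t : Q} {L ds : List Q} (h : (t :: (L ++ ds)).Nodup)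
    (hlen : L.length ≤ ds.length) (σ : Bits Q) :
    run (multiControl t L ds) σ = Function.update σ t (σ t + conj σ L) := by
  rcases L with _ | ⟨l, ls⟩
  · rfl
  rcases ds with _ | ⟨d, ds⟩
  · simp at hlen
  have hd : (d :: (ls ++ ds)).Nodup := by
    simp [List.nodup_append] at h ⊢
    grind
  have ht : ∀ g ∈ ladder d ls ds, ∀ q ∈ g.wires, q ∈ {q | q ≠ t} := by
    intro g hg q hq
    have := ladder_wires g hg q hq
    simp [List.nodup_append] at h ⊢
    grind
  funext q
  rw [multiControl, run_append, Function.update_apply]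
  split_ifs with e
  · subst e
    rw [run_apply_of_not_target fun g hg e => ht g hg q (by simp [CX.wires, e]) rfl]
    exact ladder_apply h hlen σ
  -- Away from `t` the first ladder did the same as the inner one, which is now applied a second
  -- time and cancels.
  · rw [run_congr (τ := run (ladder d ls ds) σ) ht
      (fun r hr => by rw [ladder_cons_apply h, if_neg hr]) q e]
    conv_lhs => enter [1]; rw [← ladder_reverse]
    rw [run_reverse_run (ladder_valid hd)]

end Ladder

/-! ### Carry look-ahead on a binary tree -/

section Tree

/-- A binary tree over data wires (the leaves). An inner node holds a wire for the conjunction of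
its leaves and a wire for the carry into its right subtree. -/
inductive CarryTree (Q : Type) : Type where
  | leaf (x : Q) : CarryTree Q
  | node (l r : CarryTree Q) (a z : Q) : CarryTree Q

namespace CarryTree

variable {Q : Type}

/-- The data wires, from left to right. -/
def leaves : CarryTree Q → List Q
  | leaf x => [x]
  | node l r _ _ => l.leaves ++ r.leaves

/-- The wires for conjunctions. -/
def ands : CarryTree Q → List Q
  | leaf _ => []
  | node l r a _ => a :: (l.ands ++ r.ands)

/-- The wires for carries. -/
def carries : CarryTree Q → List Q
  | leaf _ => []
  | node l r _ z => z :: (l.carries ++ r.carries)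

/-- The wire that holds the conjunction of the leaves. -/
def root : CarryTree Q → Q
  | leaf x => x
  | node _ _ a _ => a

/-- The length of a longest branch. -/
def height : CarryTree Q → ℕ
  | leaf _ => 0
  | node l r _ _ => max l.height r.height + 1

/-- The wires of a tree are distinct. -/
def WF (t : CarryTree Q) : Prop := (t.leaves ++ (t.ands ++ t.carries)).Nodup

/-- Computes all conjunctions. -/
def up : CarryTree Q → List (CX Q)
  | leaf _ => []
  | node l r a _ => (l.up ++ r.up) ++ [⟨[l.root, r.root], a⟩]

/-- Computes all carries from the carry on the wire `c`. -/
def down : Q → CarryTree Q → List (CX Q)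
  | _, leaf _ => []
  | c, node l r _ z => [⟨[c, l.root], z⟩] ++ (down z r ++ down c l)

/-- Adds the carries to the leaves. -/
def addCarries : Q → CarryTree Q → List (CX Q)
  | c, leaf x => [⟨[c], x⟩]
  | c, node l r _ z => addCarries z r ++ addCarries c l

/-- All conjunction wires hold their values. -/
def Summed (σ : Bits Q) : CarryTree Q → Prop
  | leaf _ => True
  | node l r a _ => σ a = conj σ (l.leaves ++ r.leaves) ∧ l.Summed σ ∧ r.Summed σ

/-- All carry wires hold their values for the incoming carry `g`. -/
def Carried (σ : Bits Q) : Fin 2 → CarryTree Q → Prop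
  | _, leaf _ => True
  | g, node l r _ z =>
      σ z = g * conj σ l.leaves ∧ l.Carried σ g ∧ r.Carried σ (g * conj σ l.leaves)

theorem root_mem (t : CarryTree Q) : t.root ∈ t.leaves ∨ t.root ∈ t.ands := by
  cases t <;> simp [root, leaves, ands]

theorem wf_node {l r : CarryTree Q} {a z : Q} (h : (node l r a z).WF) : l.WF ∧ r.WF := by
  simp only [WF, leaves, ands, carries, List.nodup_append, List.nodup_cons, List.mem_append,
    List.mem_cons] at h ⊢
  grind

theorem summed_congr {t : CarryTree Q} {σ τ : Bits Q} (h : ∀ q ∈ t.leaves, σ q = τ q)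
    (h' : ∀ q ∈ t.ands, σ q = τ q) (hs : t.Summed σ) : t.Summed τ := by
  induction t with
  | leaf x => trivial
  | node l r a z hl hr =>
    simp only [leaves, ands, List.mem_append, List.mem_cons] at h h'
    refine ⟨?_, hl (by grind) (by grind) hs.2.1, hr (by grind) (by grind) hs.2.2⟩
    rw [← h' a (by simp), hs.1, conj_congr (by simpa using h)]

theorem carried_congr {t : CarryTree Q} {g : Fin 2} {σ τ : Bits Q}
    (h : ∀ q ∈ t.leaves, σ q = τ q) (h' : ∀ q ∈ t.carries, σ q = τ q) (hs : t.Carried σ g) :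
    t.Carried τ g := by
  induction t generalizing g with
  | leaf x => trivial
  | node l r a z hl hr =>
    simp only [leaves, carries, List.mem_append, List.mem_cons] at h h'
    have hc : conj σ l.leaves = conj τ l.leaves := conj_congr (by grind)
    refine ⟨?_, hl (by grind) (by grind) hs.2.1, hc ▸ hr (by grind) (by grind) hs.2.2⟩
    rw [← h' z (by simp), hs.1, hc]

theorem Summed.root {t : CarryTree Q} {σ : Bits Q} (h : t.Summed σ) :
    σ t.root = conj σ t.leaves := by
  cases t with
  | leaf x =>
    simp only [CarryTree.root, leaves, conj]
    generalize σ x = a; revert a; decide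
  | node l r a z => exact h.1

theorem carried_zero_iff {t : CarryTree Q} {σ : Bits Q} :
    t.Carried σ 0 ↔ ∀ q ∈ t.carries, σ q = 0 := by
  have : ∀ a : Fin 2, 0 * a = 0 := by decide
  induction t with
  | leaf x => simp [Carried, carries]
  | node l r a z hl hr => simp [Carried, carries, this, hl, hr, or_imp, forall_and]

theorem up_wires {t : CarryTree Q} :
    ∀ g ∈ t.up, ∀ q ∈ g.wires, q ∈ t.leaves ∨ q ∈ t.ands := by
  induction t with
  | leaf x => simp [up]
  | node l r a z hl hr =>
    intro g hg q hq
    have := l.root_mem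
    have := r.root_mem
    simp only [up, List.mem_append, List.mem_singleton] at hg
    simp only [leaves, ands, List.mem_append, List.mem_cons]
    rcases hg with (hg | hg) | rfl
    · have := hl g hg q hq; grind
    · have := hr g hg q hq; grind
    · simp [CX.wires] at hq; grind

theorem up_target {t : CarryTree Q} : ∀ g ∈ t.up, g.target ∈ t.ands := by
  induction t with
  | leaf x => simp [up]
  | node l r a z hl hr =>
    intro g hg
    simp only [up, List.mem_append, List.mem_singleton] at hg
    simp only [ands, List.mem_append, List.mem_cons]
    rcases hg with (hg | hg) | rfl
    · have := hl g hg; grind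
    · have := hr g hg; grind
    · simp

theorem down_wires {t : CarryTree Q} {c : Q} :
    ∀ g ∈ t.down c, ∀ q ∈ g.wires, q = c ∨ q ∈ t.leaves ∨ q ∈ t.ands ∨ q ∈ t.carries := by
  induction t generalizing c with
  | leaf x => simp [down]
  | node l r a z hl hr =>
    intro g hg q hq
    have := l.root_mem
    simp only [down, List.mem_append, List.mem_singleton] at hg
    simp only [leaves, ands, carries, List.mem_append, List.mem_cons]
    rcases hg with rfl | hg | hg
    · simp [CX.wires] at hq; grind
    · have := hr g hg q hq; grind
    · have := hl g hg q hq; grind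

theorem down_target {t : CarryTree Q} {c : Q} : ∀ g ∈ t.down c, g.target ∈ t.carries := by
  induction t generalizing c with
  | leaf x => simp [down]
  | node l r a z hl hr =>
    intro g hg
    simp only [down, List.mem_append, List.mem_singleton] at hg
    simp only [carries, List.mem_append, List.mem_cons]
    rcases hg with rfl | hg | hg
    · simp
    · have := hr g hg; grind
    · have := hl g hg; grind

theorem addCarries_wires {t : CarryTree Q} {c : Q} :
    ∀ g ∈ t.addCarries c, ∀ q ∈ g.wires, q = c ∨ q ∈ t.leaves ∨ q ∈ t.carries := by
  induction t generalizing c with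
  | leaf x => simp [addCarries, CX.wires, leaves]
  | node l r a z hl hr =>
    intro g hg q hq
    simp only [addCarries, List.mem_append] at hg
    simp only [leaves, carries, List.mem_append, List.mem_cons]
    rcases hg with hg | hg
    · have := hr g hg q hq; grind
    · have := hl g hg q hq; grind

theorem addCarries_target {t : CarryTree Q} {c : Q} :
    ∀ g ∈ t.addCarries c, g.target ∈ t.leaves := by
  induction t generalizing c with
  | leaf x => simp [addCarries, leaves]
  | node l r a z hl hr =>
    intro g hg
    simp only [addCarries, List.mem_append] at hg
    simp only [leaves, List.mem_append]
    rcases hg with hg | hg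
    · exact .inr (hr g hg)
    · exact .inl (hl g hg)

theorem up_valid {t : CarryTree Q} (h : t.WF) : Valid t.up := by
  induction t with
  | leaf x => exact Valid.nil
  | node l r a z hl hr =>
    have := l.root_mem
    have := r.root_mem
    have hlr := wf_node h
    refine ((hl hlr.1).append (hr hlr.2)).append (Valid.cons ?_ Valid.nil)
    simp [WF, leaves, ands, carries, List.nodup_append, CX.wires] at h ⊢
    grind

theorem down_valid {t : CarryTree Q} {c : Q} (h : t.WF) (hc : c ∉ t.leaves) (ha : c ∉ t.ands)
    (hz : c ∉ t.carries) : Valid (t.down c) := by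
  induction t generalizing c with
  | leaf x => exact Valid.nil
  | node l r a z hl hr =>
    have := l.root_mem
    have hlr := wf_node h
    simp only [WF, leaves, ands, carries, List.nodup_append, List.nodup_cons, List.mem_append,
      List.mem_cons] at h hc ha hz
    refine Valid.append (Valid.cons ?_ Valid.nil) (Valid.append (hr hlr.2 ?_ ?_ ?_)
      (hl hlr.1 ?_ ?_ ?_))
    · simp [CX.wires]
      grind
    all_goals grind

theorem addCarries_valid {t : CarryTree Q} {c : Q} (h : t.WF) (hc : c ∉ t.leaves) :
    Valid (t.addCarries c) := by
  induction t generalizing c with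
  | leaf x =>
    refine Valid.cons ?_ Valid.nil
    simp [CX.wires, leaves] at hc ⊢
    grind
  | node l r a z hl hr =>
    have hlr := wf_node h
    simp only [WF, leaves, ands, carries, List.nodup_append, List.nodup_cons, List.mem_append,
      List.mem_cons] at h hc
    exact Valid.append (hr hlr.2 (by grind)) (hl hlr.1 (by grind))

theorem up_length (t : CarryTree Q) : t.up.length + 1 = t.leaves.length := by
  induction t with
  | leaf x => simp [up, leaves]
  | node l r a z hl hr => simp [up, leaves]; omega

theorem down_length (t : CarryTree Q) (c : Q) : (t.down c).length + 1 = t.leaves.length := by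
  induction t generalizing c with
  | leaf x => simp [down, leaves]
  | node l r a z hl hr => have := hl c; have := hr z; simp [down, leaves]; omega

theorem addCarries_length (t : CarryTree Q) (c : Q) :
    (t.addCarries c).length = t.leaves.length := by
  induction t generalizing c with
  | leaf x => simp [addCarries, leaves]
  | node l r a z hl hr => have := hl c; have := hr z; simp [addCarries, leaves]; omega

theorem up_depthLE {t : CarryTree Q} (h : t.WF) : DepthLE t.up t.height := by
  induction t with
  | leaf x => exact .nil
  | node l r a z hl hr =>
    have hlr := wf_node h
    refine (DepthLE.par ((hl hlr.1).mono (le_max_left _ _)) ((hr hlr.2).mono (le_max_right _ _))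
      fun g hg g' hg' q hq hq' => ?_).seq (.gate _)
    have := up_wires g hg q hq
    have := up_wires g' hg' q hq'
    simp only [WF, leaves, ands, carries, List.nodup_append, List.nodup_cons, List.mem_append,
      List.mem_cons] at h
    grind

/-- Once the carry into the right subtree is on `z`, the two subtrees read different incoming
carries and share no wire, so each level costs one layer. -/
theorem down_depthLE {t : CarryTree Q} {c : Q} (h : t.WF) (hc : c ∉ t.leaves) (ha : c ∉ t.ands)
    (hz : c ∉ t.carries) : DepthLE (t.down c) t.height := by
  induction t generalizing c with
  | leaf x => exact .nil
  | node l r a z hl hr =>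
    have hlr := wf_node h
    simp only [WF, leaves, ands, carries, List.nodup_append, List.nodup_cons, List.mem_append,
      List.mem_cons] at h hc ha hz
    refine ((DepthLE.gate _).seq (DepthLE.par
      ((hr hlr.2 ?_ ?_ ?_).mono (le_max_right l.height _))
      ((hl hlr.1 ?_ ?_ ?_).mono (le_max_left _ _))
      fun g hg g' hg' q hq hq' => ?_)).mono (by simp [height]; omega)
    case refine_7 =>
      have := down_wires g hg q hq
      have := down_wires g' hg' q hq'
      grind
    all_goals grind

/-- Every carry wire feeds a single leaf, the leftmost one of its right subtree, and `c` feeds only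
the first leaf. Hence all these CNOTs are disjoint. -/
theorem addCarries_depthLE {t : CarryTree Q} {c : Q} (h : t.WF) (hc : c ∉ t.leaves)
    (hz : c ∉ t.carries) : DepthLE (t.addCarries c) 1 := by
  induction t generalizing c with
  | leaf x => exact .gate _
  | node l r a z hl hr =>
    have hlr := wf_node h
    simp only [WF, leaves, ands, carries, List.nodup_append, List.nodup_cons, List.mem_append,
      List.mem_cons] at h hc hz
    refine DepthLE.par (hr hlr.2 ?_ ?_) (hl hlr.1 ?_ ?_) fun g hg g' hg' q hq hq' => ?_
    case refine_5 =>
      have := addCarries_wires g hg q hq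
      have := addCarries_wires g' hg' q hq'
      grind
    all_goals grind

/-- A balanced tree on given wires. -/
theorem exists_tree (e : ℕ) : ∀ xs ws : List Q, xs ≠ [] → xs.length ≤ 2 ^ e →
    ws.length + 2 = 2 * xs.length →
    ∃ t : CarryTree Q, t.leaves = xs ∧ (t.ands ++ t.carries).Perm ws ∧ t.height ≤ e := by
  induction e with
  | zero =>
    intro xs ws h0 h1 h2
    obtain ⟨x, rfl⟩ : ∃ x, xs = [x] := List.length_eq_one_iff.1 (by
      have := List.length_pos_iff.2 h0; simp at h1; omega)
    have : ws = [] := List.length_eq_zero_iff.1 (by simp only [List.length_singleton] at h2; omega)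
    exact ⟨leaf x, rfl, by simp [this, ands, carries], by simp [height]⟩
  | succ e ih =>
    intro xs ws h0 h1 h2
    have hpos := List.length_pos_iff.2 h0
    by_cases hx : xs.length = 1
    · obtain ⟨x, rfl⟩ := List.length_eq_one_iff.1 hx
      have : ws = [] := List.length_eq_zero_iff.1 (by simp only [List.length_singleton] at h2; omega)
      exact ⟨leaf x, rfl, by simp [this, ands, carries], by simp [height]⟩
    rcases ws with _ | ⟨a, _ | ⟨z, ws⟩⟩
    · simp at h2; omega
    · simp at h2; omega
    simp only [List.length_cons] at h2
    have hp : 2 ^ (e + 1) = 2 * 2 ^ e := by ring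
    -- A tree with `m` leaves has `m - 1` inner nodes with two wires each, so the left half takes `2
    -- * m - 2` of the remaining wires.
    set m := xs.length / 2 with hm
    obtain ⟨l, hl, hl', hle⟩ := ih (xs.take m) (ws.take (2 * m - 2))
      (by rw [← List.length_pos_iff, List.length_take]; omega)
      (by rw [List.length_take]; omega) (by simp only [List.length_take]; omega)
    obtain ⟨r, hr, hr', hre⟩ := ih (xs.drop m) (ws.drop (2 * m - 2))
      (by rw [← List.length_pos_iff, List.length_drop]; omega)
      (by rw [List.length_drop]; omega) (by simp only [List.length_drop]; omega)
    refine ⟨node l r a z, by simp [leaves, hl, hr], ?_, by simp [height]; omega⟩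
    classical
    have := hl'.append hr'
    rw [List.take_append_drop] at this
    rw [List.perm_iff_count] at this ⊢
    intro q
    have := this q
    simp only [ands, carries, List.cons_append, List.count_cons, List.count_append] at this ⊢
    omega

variable [DecidableEq Q]

theorem up_summed {t : CarryTree Q} (h : t.WF) {σ : Bits Q} (ha : ∀ q ∈ t.ands, σ q = 0) :
    t.Summed (run t.up σ) := by
  induction t generalizing σ with
  | leaf x => trivial
  | node l r a z hl hr =>
    have hlr := wf_node h
    have hrl := l.root_mem
    have hrr := r.root_mem
    simp only [ands, List.mem_append, List.mem_cons] at ha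
    simp only [WF, leaves, ands, carries, List.nodup_append, List.nodup_cons, List.mem_append,
      List.mem_cons] at h
    have h1 : ∀ q, q ∉ l.ands → ∀ τ, run l.up τ q = τ q := fun q hq τ =>
      run_apply_of_not_target (q := q) (fun g hg e => hq (e ▸ up_target g hg)) τ
    have h2 : ∀ q, q ∉ r.ands → ∀ τ, run r.up τ q = τ q := fun q hq τ =>
      run_apply_of_not_target (q := q) (fun g hg e => hq (e ▸ up_target g hg)) τ
    have hL : l.Summed (run r.up (run l.up σ)) :=
      summed_congr (fun q hq => (h2 q (by grind -ring) _).symm) (fun q hq => (h2 q (by grind -ring) _).symm)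
        (hl hlr.1 (by grind -ring))
    have hR : r.Summed (run r.up (run l.up σ)) :=
      hr hlr.2 fun q hq => by rw [h1 q (by grind -ring)]; grind -ring
    have ha' : run r.up (run l.up σ) a = 0 := by
      rw [h2 a (by grind -ring), h1 a (by grind -ring)]; grind -ring
    rw [up, run_append, run_append]
    generalize run r.up (run l.up σ) = τ at *
    have hq : ∀ q, q ≠ a → τ q = run [⟨[l.root, r.root], a⟩] τ q := fun q hq => by
      simp [run, CX.act, hq]
    refine ⟨?_, summed_congr (fun q hq' => hq q (by grind -ring)) (fun q hq' => hq q (by grind -ring)) hL,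
      summed_congr (fun q hq' => hq q (by grind -ring)) (fun q hq' => hq q (by grind -ring)) hR⟩
    rw [← conj_congr (σ := τ) (fun q hq' => hq q (by grind -ring)), conj_append, ← hL.root, ← hR.root]
    simp only [run, CX.act, Function.update_self, ha', conj]
    generalize τ l.root = x; generalize τ r.root = y
    revert x y; decide

theorem down_carried {t : CarryTree Q} {c : Q} (h : t.WF) (hc : c ∉ t.leaves) (ha : c ∉ t.ands)
    (hz : c ∉ t.carries) {σ : Bits Q} (hs : t.Summed σ) (h0 : t.Carried σ 0) :
    t.Carried (run (t.down c) σ) (σ c) := by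
  induction t generalizing c σ with
  | leaf x => trivial
  | node l r a z hl hr =>
    have hlr := wf_node h
    simp only [WF, leaves, ands, carries, List.nodup_append, List.nodup_cons, List.mem_append,
      List.mem_cons] at h hc ha hz
    rw [carried_zero_iff] at h0
    simp only [carries, List.mem_append, List.mem_cons] at h0
    have h1 : ∀ q, q ∉ l.carries → ∀ τ, run (l.down c) τ q = τ q := fun q hq τ =>
      run_apply_of_not_target (q := q) (fun g hg e => hq (e ▸ down_target g hg)) τ
    have h2 : ∀ q, q ∉ r.carries → ∀ τ, run (r.down z) τ q = τ q := fun q hq τ =>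
      run_apply_of_not_target (q := q) (fun g hg e => hq (e ▸ down_target g hg)) τ
    rw [down, run_append, run_append]
    have hτz : run [⟨[c, l.root], z⟩] σ z = σ c * conj σ l.leaves := by
      rw [← hs.2.1.root]
      simp only [run, CX.act, Function.update_self, h0 z (by simp), conj]
      generalize σ c = x; generalize σ l.root = y
      revert x y; decide
    have hτ : ∀ q, q ≠ z → run [⟨[c, l.root], z⟩] σ q = σ q := fun q hq => by
      simp [run, CX.act, hq]
    generalize run [⟨[c, l.root], z⟩] σ = τ at *
    have hR := hr hlr.2 (c := z) (σ := τ) (by grind -ring) (by grind -ring) (by grind -ring)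
      (summed_congr (fun q hq => (hτ q (by grind -ring)).symm) (fun q hq => (hτ q (by grind -ring)).symm)
        hs.2.2)
      (carried_zero_iff.2 fun q hq => by rw [hτ q (by grind -ring)]; exact h0 q (by grind -ring))
    have hτ' : ∀ q, q ≠ z → q ∉ r.carries → run (r.down z) τ q = σ q := fun q hq hq' => by
      rw [h2 q hq', hτ q hq]
    have hz' : run (r.down z) τ z = σ c * conj σ l.leaves := by rw [h2 z (by grind -ring), hτz]
    rw [hτz] at hR
    generalize run (r.down z) τ = ρ at *
    have hL := hl hlr.1 (c := c) (σ := ρ) (by grind -ring) (by grind -ring) (by grind -ring)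
      (summed_congr (fun q hq => (hτ' q (by grind -ring) (by grind -ring)).symm)
        (fun q hq => (hτ' q (by grind -ring) (by grind -ring)).symm) hs.2.1)
      (carried_zero_iff.2 fun q hq => by rw [hτ' q (by grind -ring) (by grind -ring)]; exact h0 q (by grind -ring))
    rw [hτ' c (by grind -ring) (by grind -ring)] at hL
    have hconj : conj (run (l.down c) ρ) l.leaves = conj σ l.leaves := conj_congr fun q hq => by
      rw [h1 q (by grind -ring), hτ' q (by grind -ring) (by grind -ring)]
    refine ⟨?_, hL, ?_⟩
    · rw [hconj, h1 z (by grind -ring), hz']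
    · rw [hconj]
      exact carried_congr (fun q hq => (h1 q (by grind -ring) _).symm)
        (fun q hq => (h1 q (by grind -ring) _).symm) hR

/-- In reverse order the incoming carry of a node and the conjunction of its left leaves are still
present when its own carry is treated, so the gate that would compute this carry clears it. -/
theorem down_reverse_carried {t : CarryTree Q} {c : Q} (h : t.WF) (hc : c ∉ t.leaves)
    (ha : c ∉ t.ands) (hz : c ∉ t.carries) {σ : Bits Q} (hs : t.Summed σ)
    (h0 : t.Carried σ (σ c)) : t.Carried (run (t.down c).reverse σ) 0 := by
  induction t generalizing c σ with
  | leaf x => trivial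
  | node l r a z hl hr =>
    have hlr := wf_node h
    have hrl := l.root_mem
    simp only [WF, leaves, ands, carries, List.nodup_append, List.nodup_cons, List.mem_append,
      List.mem_cons] at h hc ha hz
    have h1 : ∀ q, q ∉ l.carries → ∀ τ, run (l.down c).reverse τ q = τ q := fun q hq τ =>
      run_apply_of_not_target (q := q) (fun g hg e => hq (e ▸ down_target g (by simpa using hg))) τ
    have h2 : ∀ q, q ∉ r.carries → ∀ τ, run (r.down z).reverse τ q = τ q := fun q hq τ =>
      run_apply_of_not_target (q := q) (fun g hg e => hq (e ▸ down_target g (by simpa using hg))) τ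
    have hL := hl hlr.1 (by grind -ring) (by grind -ring) (by grind -ring) hs.2.1 h0.2.1
    simp only [down, List.reverse_append, run_append, List.reverse_singleton]
    have hτ : ∀ q, q ∉ l.carries → run (l.down c).reverse σ q = σ q := fun q hq => h1 q hq σ
    generalize run (l.down c).reverse σ = τ at *
    have hR := hr hlr.2 (c := z) (σ := τ) (by grind -ring) (by grind -ring) (by grind -ring)
      (summed_congr (fun q hq => (hτ q (by grind -ring)).symm) (fun q hq => (hτ q (by grind -ring)).symm)
        hs.2.2)
      (by
        rw [hτ z (by grind -ring), h0.1]
        exact carried_congr (fun q hq => (hτ q (by grind -ring)).symm)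
          (fun q hq => (hτ q (by grind -ring)).symm) h0.2.2)
    have hρ : ∀ q, q ∉ r.carries → run (r.down z).reverse τ q = τ q := fun q hq => h2 q hq τ
    generalize run (r.down z).reverse τ = ρ at *
    rw [carried_zero_iff] at hL hR ⊢
    have hz0 : ρ z = σ c * σ l.root := by
      rw [hρ z (by grind -ring), hτ z (by grind -ring), h0.1, hs.2.1.root]
    have hρc : ρ c = σ c := by rw [hρ c (by grind -ring), hτ c (by grind -ring)]
    have hρr : ρ l.root = σ l.root := by rw [hρ _ (by grind -ring), hτ _ (by grind -ring)]
    have hq : ∀ q, q ≠ z → run [⟨[c, l.root], z⟩] ρ q = ρ q := fun q hq => by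
      simp [run, CX.act, hq]
    intro q hq'
    simp only [carries, List.mem_append, List.mem_cons] at hq'
    by_cases e : q = z
    · subst e
      simp only [run, CX.act, Function.update_self, conj, hz0, hρc, hρr]
      generalize σ c = x; generalize σ l.root = y
      revert x y; decide
    · rw [hq q e]
      rcases hq' with h' | h' | h'
      · exact absurd h' e
      · rw [hρ q (by grind -ring)]; exact hL q h'
      · exact hR q h'

theorem run_addCarries {t : CarryTree Q} {c : Q} (h : t.WF) (hc : c ∉ t.leaves)
    {σ : Bits Q} (h0 : t.Carried σ (σ c)) :
    run (t.addCarries c) σ = ripple (σ c) t.leaves σ := by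
  induction t generalizing c σ with
  | leaf x =>
    simp [addCarries, leaves, run, CX.act, ripple, conj]
  | node l r a z hl hr =>
    have hlr := wf_node h
    simp only [WF, leaves, ands, carries, List.nodup_append, List.nodup_cons, List.mem_append,
      List.mem_cons] at h hc
    rw [addCarries, run_append, leaves, ripple_append (by grind -ring),
      hr hlr.2 (c := z) (by grind -ring) (h0.1 ▸ h0.2.2), h0.1]
    have hq : ∀ q, q ∉ r.leaves → σ q = ripple (σ c * conj σ l.leaves) r.leaves σ q :=
      fun q hq => (ripple_apply_of_notMem hq σ).symm
    generalize ripple (σ c * conj σ l.leaves) r.leaves σ = τ at *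
    rw [hl hlr.1 (c := c) (by grind -ring), ← hq c (by grind -ring)]
    rw [← hq c (by grind -ring)]
    exact carried_congr (fun q hq' => hq q (by grind -ring)) (fun q hq' => hq q (by grind -ring)) h0.2.1

/-- A digit reached by a carry is flipped twice, by the carry and by the complement, and keeps its
value. A digit not reached by a carry has no influence on the carry out, which is 0 for both
numbers. -/
theorem mul_conj_of_not_ripple {g : Fin 2} {L : List Q} {σ τ : Bits Q} (hL : L.Nodup)
    (h : ∀ q ∈ L, τ q = ripple g L σ q + 1) : g * conj τ L = g * conj σ L := by
  induction L generalizing g with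
  | nil => rfl
  | cons x L ih =>
    have hx : τ x = σ x + g + 1 := by simpa [ripple] using h x (by simp)
    have hi := ih (g := g * σ x) hL.of_cons fun q hq => by
      have hqx : q ≠ x := by rintro rfl; simp at hL; exact hL.1 hq
      rw [h q (by simp [hq])]
      simp [ripple, hqx]
    simp only [conj, hx]
    clear h hx ih
    revert hi
    generalize σ x = a; generalize conj τ L = b; generalize conj σ L = d
    revert a b d g; decide

/-- Complementing the incremented number leaves the carries valid. -/
theorem Carried.of_not_ripple {t : CarryTree Q} (h : t.WF) {g : Fin 2} {σ τ : Bits Q}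
    (hz : ∀ q ∈ t.carries, τ q = σ q) (hx : ∀ q ∈ t.leaves, τ q = ripple g t.leaves σ q + 1)
    (h0 : t.Carried σ g) : t.Carried τ g := by
  induction t generalizing g with
  | leaf x => trivial
  | node l r a z hl hr =>
    have hlr := wf_node h
    simp only [WF, leaves, ands, carries, List.nodup_append, List.nodup_cons, List.mem_append,
      List.mem_cons] at h hz hx
    rw [ripple_append (by grind -ring)] at hx
    have hxl : ∀ q ∈ l.leaves, τ q = ripple g l.leaves σ q + 1 := fun q hq => by
      rw [hx q (.inl hq)]
      congr 1
      have hs : ∀ q ∈ l.leaves, ripple (g * conj σ l.leaves) r.leaves σ q = σ q := fun q hq =>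
        ripple_apply_of_notMem (by grind -ring) σ
      exact ripple_congr hs (hs q hq)
    have hc := mul_conj_of_not_ripple (by grind -ring) hxl
    refine ⟨?_, hl hlr.1 (by grind -ring) hxl h0.2.1, ?_⟩
    · rw [hz z (by simp), h0.1, hc]
    · rw [hc]
      refine hr hlr.2 (by grind -ring) (fun q hq => ?_) h0.2.2
      rw [hx q (.inr hq), ripple_apply_of_notMem (by grind -ring)]

end CarryTree
end Tree

/-! ### Incrementing a block under controls with conditionally clean wires -/

section ConditionalIncrement

variable {Q : Type}

/-- Negates all wires in `xs`. -/
def flip (xs : List Q) : List (CX Q) := xs.map fun x => ⟨[], x⟩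

theorem flip_valid (xs : List Q) : Valid (flip xs) := by
  simp [Valid, flip, CX.wires]

theorem flip_depthLE {xs : List Q} (h : xs.Nodup) : DepthLE (flip xs) 1 := by
  induction xs with
  | nil => exact DepthLE.nil.mono (by simp)
  | cons x xs ih =>
    refine DepthLE.par (A := [⟨[], x⟩]) (.gate _) (ih h.of_cons) ?_
    simp [CX.wires] at h ⊢
    grind

/-- For a clean wire `c` and clean tree wires, computes `c` and the carry wires if the conjunction
of `L` holds, and undoes this if it was done before. -/
def loadCarries (t : CarryTree Q) (c : Q) (L ds : List Q) : List (CX Q) :=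
  (t.up ++ (t.down c).reverse) ++ (multiControl c L ds ++ (t.down c ++ t.up.reverse))

/-- Increments the leaves of `t` by the conjunction of `L`. -/
def treeIncrement (t : CarryTree Q) (c : Q) (L ds : List Q) : List (CX Q) :=
  ((t.addCarries c).reverse ++ (loadCarries t c L ds ++ t.addCarries c)) ++
    (flip t.leaves ++ (loadCarries t c L ds ++ flip t.leaves))

/-- Adds the conjunction of the leaves of `t` to `c` and negates the leaves. -/
def treeFlag (t : CarryTree Q) (c : Q) : List (CX Q) :=
  t.up ++ ([⟨[t.root], c⟩] ++ (t.up.reverse ++ flip t.leaves))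

/-- The wires used by `loadCarries` are distinct, apart from those that are borrowed. -/
structure Layout (t : CarryTree Q) (c : Q) (L ds : List Q) : Prop where
  wf : t.WF
  leaves : c ∉ t.leaves
  ands : c ∉ t.ands
  carries : c ∉ t.carries
  notMem_of_mem : ∀ q ∈ L, q ∉ t.leaves ∧ q ∉ t.ands ∧ q ∉ t.carries
  nodup : (c :: (L ++ ds)).Nodup
  le : L.length ≤ ds.length

theorem CarryTree.WF.disjoint {t : CarryTree Q} (h : t.WF) :
    (∀ q ∈ t.leaves, q ∉ t.ands ∧ q ∉ t.carries) ∧ ∀ q ∈ t.ands, q ∉ t.carries := by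
  simp only [CarryTree.WF, List.nodup_append, List.mem_append] at h
  grind

theorem CarryTree.WF.leaves_nodup {t : CarryTree Q} (h : t.WF) : t.leaves.Nodup := by
  simp only [CarryTree.WF, List.nodup_append] at h
  exact h.1

theorem loadCarries_valid {t : CarryTree Q} {c : Q} {L ds : List Q} (h : Layout t c L ds) :
    Valid (loadCarries t c L ds) :=
  have hu := CarryTree.up_valid h.wf
  have hd := CarryTree.down_valid h.wf h.leaves h.ands h.carries
  (hu.append hd.reverse).append ((multiControl_valid h.nodup).append (hd.append hu.reverse))

theorem loadCarries_depthLE {t : CarryTree Q} {c : Q} {L ds : List Q} (h : Layout t c L ds) :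
    DepthLE (loadCarries t c L ds) (4 * t.height + 4 * L.length + 2) := by
  have hu := CarryTree.up_depthLE h.wf
  have hd := CarryTree.down_depthLE h.wf h.leaves h.ands h.carries
  exact ((hu.seq hd.reverse).seq (((DepthLE.length _).mono (multiControl_length c L ds)).seq
    (hd.seq hu.reverse))).mono (by omega)

theorem loadCarries_length (t : CarryTree Q) (c : Q) (L ds : List Q) :
    (loadCarries t c L ds).length ≤ 4 * t.leaves.length + 4 * L.length + 2 := by
  have := t.up_length
  have := t.down_length c
  have := multiControl_length c L ds
  simp [loadCarries]
  omega

theorem treeIncrement_valid {t : CarryTree Q} {c : Q} {L ds : List Q} (h : Layout t c L ds) :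
    Valid (treeIncrement t c L ds) :=
  have ha := CarryTree.addCarries_valid h.wf h.leaves
  have hl := loadCarries_valid h
  (ha.reverse.append (hl.append ha)).append
    ((flip_valid _).append (hl.append (flip_valid _)))

theorem treeIncrement_depthLE {t : CarryTree Q} {c : Q} {L ds : List Q} (h : Layout t c L ds) :
    DepthLE (treeIncrement t c L ds) (8 * t.height + 8 * L.length + 8) := by
  have ha := CarryTree.addCarries_depthLE h.wf h.leaves h.carries
  have hl := loadCarries_depthLE h
  have hf := flip_depthLE h.wf.leaves_nodup
  exact ((ha.reverse.seq (hl.seq ha)).seq (hf.seq (hl.seq hf))).mono (by omega)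

theorem treeIncrement_length (t : CarryTree Q) (c : Q) (L ds : List Q) :
    (treeIncrement t c L ds).length ≤ 12 * t.leaves.length + 8 * L.length + 4 := by
  have := t.addCarries_length c
  have := loadCarries_length t c L ds
  simp [treeIncrement, flip]
  omega

theorem treeFlag_valid {t : CarryTree Q} {c : Q} {L ds : List Q} (h : Layout t c L ds) :
    Valid (treeFlag t c) := by
  have hu := CarryTree.up_valid h.wf
  refine hu.append ((Valid.cons ?_ Valid.nil).append (hu.reverse.append (flip_valid _)))
  have := t.root_mem
  have := h.leaves
  have := h.ands
  simp [CX.wires]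
  grind

theorem treeFlag_depthLE {t : CarryTree Q} {c : Q} (h : t.WF) :
    DepthLE (treeFlag t c) (2 * t.height + 2) := by
  have hu := CarryTree.up_depthLE h
  exact (hu.seq ((DepthLE.gate _).seq (hu.reverse.seq (flip_depthLE h.leaves_nodup)))).mono
    (by omega)

theorem treeFlag_length (t : CarryTree Q) (c : Q) :
    (treeFlag t c).length ≤ 3 * t.leaves.length := by
  have := t.up_length
  simp [treeFlag, flip]
  omega

theorem treeFlag_wires {t : CarryTree Q} {c : Q} :
    ∀ g ∈ treeFlag t c, ∀ q ∈ g.wires, q = c ∨ q ∈ t.leaves ∨ q ∈ t.ands := by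
  intro g hg q hq
  have := t.root_mem
  simp only [treeFlag, flip, List.mem_append, List.mem_singleton, List.mem_reverse,
    List.mem_map] at hg
  rcases hg with hg | rfl | hg | ⟨x, hx, rfl⟩
  · exact .inr (CarryTree.up_wires g hg q hq)
  · simp [CX.wires] at hq; grind
  · exact .inr (CarryTree.up_wires g hg q hq)
  · simp [CX.wires] at hq; grind

variable [DecidableEq Q]

theorem run_flip {xs : List Q} (h : xs.Nodup) (σ : Bits Q) (q : Q) :
    run (flip xs) σ q = if q ∈ xs then σ q + 1 else σ q := by
  induction xs generalizing σ with
  | nil => simp [flip, run]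
  | cons x xs ih =>
    rw [flip, List.map_cons, run]
    change run (flip xs) _ q = _
    rw [ih h.of_cons]
    by_cases e : q = x
    · subst e
      have : q ∉ xs := by simp at h; exact h.1
      simp [this, CX.act, conj]
    · simp [e, CX.act]

theorem run_up_of_notMem {t : CarryTree Q} {q : Q} (h : q ∉ t.ands) (σ : Bits Q) :
    run t.up σ q = σ q :=
  run_apply_of_not_target (q := q) (fun g hg e => h (e ▸ CarryTree.up_target g hg)) σ

theorem run_up_reverse_of_notMem {t : CarryTree Q} {q : Q} (h : q ∉ t.ands) (σ : Bits Q) :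
    run t.up.reverse σ q = σ q :=
  run_apply_of_not_target (q := q)
    (fun g hg e => h (e ▸ CarryTree.up_target g (by simpa using hg))) σ

theorem run_down_of_notMem {t : CarryTree Q} {c q : Q} (h : q ∉ t.carries) (σ : Bits Q) :
    run (t.down c) σ q = σ q :=
  run_apply_of_not_target (q := q) (fun g hg e => h (e ▸ CarryTree.down_target g hg)) σ

theorem run_down_reverse_of_notMem {t : CarryTree Q} {c q : Q} (h : q ∉ t.carries)
    (σ : Bits Q) : run (t.down c).reverse σ q = σ q :=
  run_apply_of_not_target (q := q)
    (fun g hg e => h (e ▸ CarryTree.down_target g (by simpa using hg))) σ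

/-- Changes outside the wires of `up` commute with computing and uncomputing the conjunctions. -/
theorem run_up_reverse_eq {t : CarryTree Q} (h : t.WF) {σ τ : Bits Q}
    (hτ : ∀ q, q ∈ t.leaves ∨ q ∈ t.ands → τ q = run t.up σ q) {q : Q}
    (hq : q ∈ t.leaves ∨ q ∈ t.ands) : run t.up.reverse τ q = σ q := by
  rw [run_congr (S := {q | q ∈ t.leaves ∨ q ∈ t.ands})
    (fun g hg q hq => CarryTree.up_wires g (by simpa using hg) q hq) hτ q hq,
    run_reverse_run (CarryTree.up_valid h)]

/-- Without the middle gate the circuit is a word followed by its inverse. Nothing is assumed about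
the contents of the tree wires. -/
theorem run_loadCarries_of_conj_eq_zero {t : CarryTree Q} {c : Q} {L ds : List Q}
    (h : Layout t c L ds) {σ : Bits Q} (h0 : conj σ L = 0) :
    run (loadCarries t c L ds) σ = σ := by
  have hu := CarryTree.up_valid h.wf
  have hd := CarryTree.down_valid h.wf h.leaves h.ands h.carries
  have hL : conj (run (t.down c).reverse (run t.up σ)) L = 0 := by
    rw [← h0]
    refine conj_congr fun q hq => ?_
    have := h.notMem_of_mem q hq
    rw [run_down_reverse_of_notMem this.2.2, run_up_of_notMem this.2.1]
  simp only [loadCarries, run_append]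
  rw [run_multiControl h.nodup h.le, hL, add_zero, Function.update_eq_self, run_run_reverse hd,
    run_reverse_run hu]

/-- The carries belonging to the current value of `c` are cleared, `c` is toggled, and the carries
of the new value are computed. So one circuit loads the carries if `c` is 0 and unloads them if `c`
is 1. -/
theorem run_loadCarries {t : CarryTree Q} {c : Q} {L ds : List Q} (h : Layout t c L ds)
    {σ : Bits Q} (h1 : conj σ L = 1) (ha : ∀ q ∈ t.ands, σ q = 0) (hc : t.Carried σ (σ c)) :
    t.Carried (run (loadCarries t c L ds) σ) (σ c + 1) ∧
      ∀ q, q ∉ t.carries → run (loadCarries t c L ds) σ q = if q = c then σ c + 1 else σ q := by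
  have hw := h.wf.disjoint
  have hL := h.notMem_of_mem
  have hcl := h.leaves
  have hca := h.ands
  have hcz := h.carries
  have s1 := CarryTree.up_summed h.wf ha
  have e1 : ∀ q, q ∉ t.ands → run t.up σ q = σ q := fun q hq => run_up_of_notMem hq σ
  have hback := fun τ q => @run_up_reverse_eq _ _ t h.wf σ τ (q := q)
  simp only [loadCarries, run_append]
  generalize run t.up σ = σ₁ at *
  have c2 := CarryTree.down_reverse_carried h.wf hcl hca hcz s1 (by
    rw [e1 c hca]
    exact CarryTree.carried_congr (fun q hq => (e1 q (by grind -ring)).symm)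
      (fun q hq => (e1 q (by grind -ring)).symm) hc)
  have e2 : ∀ q, q ∉ t.carries → run (t.down c).reverse σ₁ q = σ₁ q := fun q hq =>
    run_down_reverse_of_notMem hq σ₁
  generalize run (t.down c).reverse σ₁ = σ₂ at *
  have hL2 : conj σ₂ L = 1 := by
    rw [← h1]
    exact conj_congr fun q hq => by rw [e2 q (hL q hq).2.2, e1 q (hL q hq).2.1]
  rw [run_multiControl h.nodup h.le, hL2, e2 c hcz, e1 c hca]
  have e3 : ∀ q, q ≠ c → Function.update σ₂ c (σ c + 1) q = σ₂ q := fun q hq => by simp [hq]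
  have e3c : Function.update σ₂ c (σ c + 1) c = σ c + 1 := by simp
  generalize Function.update σ₂ c (σ c + 1) = σ₃ at *
  have c4 := CarryTree.down_carried h.wf hcl hca hcz (σ := σ₃)
    (CarryTree.summed_congr (fun q hq => by rw [e3 q (by grind -ring), e2 q (by grind -ring)])
      (fun q hq => by rw [e3 q (by grind -ring), e2 q (by grind -ring)]) s1)
    (CarryTree.carried_congr (fun q hq => by rw [e3 q (by grind -ring)])
      (fun q hq => by rw [e3 q (by grind -ring)]) c2)
  have e4 : ∀ q, q ∉ t.carries → run (t.down c) σ₃ q = σ₃ q := fun q hq =>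
    run_down_of_notMem hq σ₃
  rw [e3c] at c4
  generalize run (t.down c) σ₃ = σ₄ at *
  have e5 : ∀ q, q ∉ t.ands → run t.up.reverse σ₄ q = σ₄ q := fun q hq =>
    run_up_reverse_of_notMem hq σ₄
  have e6 : ∀ q, q ∈ t.leaves ∨ q ∈ t.ands → run t.up.reverse σ₄ q = σ q := fun q hq =>
    hback σ₄ q (fun q hq => by
      rw [e4 q (by grind -ring), e3 q (by grind -ring), e2 q (by grind -ring)]) hq
  refine ⟨CarryTree.carried_congr (fun q hq => (e5 q (by grind -ring)).symm)
    (fun q hq => (e5 q (by grind -ring)).symm) c4, fun q hq => ?_⟩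
  by_cases hqa : q ∈ t.ands
  · rw [e6 q (.inr hqa), if_neg (by rintro rfl; exact hca hqa)]
  · rw [e5 q hqa, e4 q hq]
    split_ifs with hqc
    · rw [hqc, e3c]
    · rw [e3 q hqc, e2 q hq, e1 q hqa]

/-- If the controls fail, both loads are trivial and what remains cancels in pairs. If they hold,
the first half adds the carries, and the second half erases them in the complemented picture. The
leading inverse of `addCarries` is there only for the first case. -/
theorem run_treeIncrement {t : CarryTree Q} {c : Q} {L ds : List Q} (h : Layout t c L ds)
    {σ : Bits Q} (h0 : conj σ L = 1 → σ c = 0 ∧ (∀ q ∈ t.ands, σ q = 0) ∧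
      ∀ q ∈ t.carries, σ q = 0) :
    run (treeIncrement t c L ds) σ = ripple (conj σ L) t.leaves σ := by
  have hw := h.wf.disjoint
  have hcl := h.leaves
  have hca := h.ands
  have hcz := h.carries
  have hadd := CarryTree.addCarries_valid h.wf hcl
  have hn := h.wf.leaves_nodup
  have hLl : ∀ q ∈ L, q ∉ t.leaves := fun q hq => (h.notMem_of_mem q hq).1
  have hLc : c ∉ L := by
    have := h.nodup
    simp only [List.nodup_cons, List.mem_append, not_or] at this
    exact this.1.1
  simp only [treeIncrement, run_append]
  rcases fin_two_eq_zero_or_one (conj σ L) with hg | hg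
  · have e : run (loadCarries t c L ds) (run (t.addCarries c).reverse σ) =
        run (t.addCarries c).reverse σ := by
      refine run_loadCarries_of_conj_eq_zero h (hg ▸ conj_congr fun q hq => ?_)
      refine run_apply_of_not_target (fun g hg' e => ?_) σ
      have := CarryTree.addCarries_target g (by simpa using hg')
      exact hLl q hq (e ▸ this)
    rw [e, run_run_reverse hadd, run_loadCarries_of_conj_eq_zero h, hg, ripple_zero]
    · funext q
      rw [run_flip hn, run_flip hn]
      split_ifs
      · exact fin_two_add_add_cancel _ _
      · rfl
    · rw [← hg]
      refine conj_congr fun q hq => ?_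
      rw [run_flip hn, if_neg (hLl q hq)]
  · obtain ⟨hc0, ha0, hz0⟩ := h0 hg
    have hc := CarryTree.carried_zero_iff.2 hz0
    -- With incoming carry 0 and clean carry wires, `addCarries` fixes `σ`, and hence so does its
    -- inverse.
    have e0 : run (t.addCarries c).reverse σ = σ := by
      have := CarryTree.run_addCarries h.wf hcl (σ := σ) (by rwa [hc0])
      rw [hc0, ripple_zero] at this
      conv_lhs => rw [← this]
      exact run_reverse_run hadd σ
    obtain ⟨c1, e1⟩ := run_loadCarries h hg ha0 (by rwa [hc0])
    rw [e0]
    rw [hc0] at c1 e1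
    generalize run (loadCarries t c L ds) σ = σ₁ at *
    have e1c : σ₁ c = 1 := by rw [e1 c hcz, if_pos rfl]; rfl
    have c1' : t.Carried σ₁ 1 := c1
    rw [CarryTree.run_addCarries h.wf hcl (by rwa [e1c]), e1c]
    have e2 : ∀ q, q ∉ t.leaves → ripple 1 t.leaves σ₁ q = σ₁ q := fun q hq =>
      ripple_apply_of_notMem hq σ₁
    have e2l : ∀ q ∈ t.leaves, ripple 1 t.leaves σ₁ q = ripple 1 t.leaves σ q := by
      have hs : ∀ q ∈ t.leaves, σ₁ q = σ q := fun q hq => by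
        rw [e1 q (by grind -ring), if_neg (by grind -ring)]
      exact fun q hq => ripple_congr hs (hs q hq)
    have e3 := run_flip hn (ripple 1 t.leaves σ₁)
    -- The loaded carries are also correct for the complemented sum, so that the second load,
    -- starting from `c = 1`, unloads them.
    have c3 : t.Carried (run (flip t.leaves) (ripple 1 t.leaves σ₁)) 1 := by
      refine CarryTree.Carried.of_not_ripple h.wf (fun q hq => ?_) (fun q hq => ?_) c1'
      · rw [e3, if_neg (by grind -ring), e2 q (by grind -ring)]
      · rw [e3, if_pos hq]
    generalize ripple 1 t.leaves σ₁ = σ₂ at *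
    generalize run (flip t.leaves) σ₂ = σ₃ at *
    have e3c : σ₃ c = 1 := by rw [e3, if_neg hcl, e2 c hcl, e1c]
    have hL3 : conj σ₃ L = 1 := by
      rw [← hg]
      refine conj_congr fun q hq => ?_
      rw [e3, if_neg (hLl q hq), e2 q (hLl q hq), e1 q (h.notMem_of_mem q hq).2.2,
        if_neg (by rintro rfl; exact hLc hq)]
    obtain ⟨c4, e4⟩ := run_loadCarries h hL3 (fun q hq => by
      rw [e3, if_neg (by grind -ring), e2 q (by grind -ring), e1 q (by grind -ring),
        if_neg (by grind -ring)]
      exact ha0 q hq) (by rwa [e3c])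
    generalize run (loadCarries t c L ds) σ₃ = σ₄ at *
    rw [e3c] at c4 e4
    have z4 := CarryTree.carried_zero_iff.1 (show t.Carried σ₄ 0 from c4)
    funext q
    rw [run_flip hn, hg]
    split_ifs with hq
    · rw [e4 q (by grind -ring), if_neg (by grind -ring), e3, if_pos hq,
        fin_two_add_add_cancel, e2l q hq]
    · rw [ripple_apply_of_notMem hq]
      by_cases hz : q ∈ t.carries
      · rw [z4 q hz, hz0 q hz]
      · rw [e4 q hz]
        split_ifs with e
        · rw [e, hc0]; rfl
        · rw [e3, if_neg hq, e2 q hq, e1 q hz, if_neg e]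

theorem run_treeFlag {t : CarryTree Q} {c : Q} {L ds : List Q} (h : Layout t c L ds)
    {σ : Bits Q} (hc : σ c = 0) (ha : ∀ q ∈ t.ands, σ q = 0) (q : Q) :
    run (treeFlag t c) σ q =
      if q = c then conj σ t.leaves else if q ∈ t.leaves then σ q + 1 else σ q := by
  have hcl := h.leaves
  have hca := h.ands
  have hw := h.wf.disjoint
  have hn := h.wf.leaves_nodup
  have hr := t.root_mem
  simp only [treeFlag, run_append]
  rw [run_flip hn]
  have s1 := (CarryTree.up_summed h.wf ha).root
  have hl : conj (run t.up σ) t.leaves = conj σ t.leaves :=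
    conj_congr fun q hq => run_up_of_notMem (hw.1 q hq).1 σ
  have e1 : ∀ q, q ∉ t.ands → run t.up σ q = σ q := fun q hq => run_up_of_notMem hq σ
  have hback := fun τ q => @run_up_reverse_eq _ _ t h.wf σ τ (q := q)
  generalize run t.up σ = σ₁ at *
  have e2 : ∀ q, q ≠ c → run [⟨[t.root], c⟩] σ₁ q = σ₁ q := fun q hq => by
    simp [run, CX.act, hq]
  have e2c : run [⟨[t.root], c⟩] σ₁ c = conj σ t.leaves := by
    simp only [run, CX.act, Function.update_self, conj, s1, hl, e1 c hca, hc]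
    generalize conj σ t.leaves = a; revert a; decide
  generalize run [⟨[t.root], c⟩] σ₁ = σ₂ at *
  have e3 : ∀ q, q ∉ t.ands → run t.up.reverse σ₂ q = σ₂ q := fun q hq =>
    run_up_reverse_of_notMem hq σ₂
  have e4 : ∀ q, q ∈ t.leaves ∨ q ∈ t.ands → run t.up.reverse σ₂ q = σ q := fun q hq =>
    hback σ₂ q (fun q hq => e2 q (by grind -ring)) hq
  by_cases e : q = c
  · rw [if_pos e, e, if_neg hcl, e3 c hca, e2c]
  rw [if_neg e]
  split_ifs with hq
  · rw [e4 q (.inl hq)]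
  · by_cases hqa : q ∈ t.ands
    · exact e4 q (.inr hqa)
    · rw [e3 q hqa, e2 q e, e1 q hqa]

end ConditionalIncrement

/-! ### Recursion over blocks with growing workspace -/

section Stages

variable {Q : Type} [DecidableEq Q]

/-- The circuit `C` increments `xs` by the conjunction of `L`, provided that the wires `W` are
clean if this conjunction holds. -/
def Increments (L W xs : List Q) (C : List (CX Q)) : Prop :=
  Valid C ∧ ∀ σ, (conj σ L = 1 → ∀ q ∈ W, σ q = 0) → run C σ = ripple (conj σ L) xs σ

/-- `A` moves the conjunction of the block `B` to the clean wire `s` and makes `B` clean if this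
conjunction holds, and `S` increments `B` by the conjunction of `L`. -/
structure Stage (L : List Q) (s : Q) (W B : List Q) (E : ℕ) (A S : List (CX Q)) : Prop where
  valid : Valid A
  wires : ∀ g ∈ A, ∀ q ∈ g.wires, q = s ∨ q ∈ W ∨ q ∈ B
  flag : ∀ σ, σ s = 0 → (∀ q ∈ W, σ q = 0) → run A σ s = conj σ B ∧
    (∀ q ∈ B, run A σ q = σ q + 1) ∧ ∀ q ∈ W, run A σ q = 0
  increments : Increments L (s :: W) B S
  depth : ∃ a b, DepthLE A a ∧ DepthLE S b ∧ 2 * a + b ≤ 12 * E + 8 * L.length + 14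
  length : 2 * A.length + S.length ≤ 18 * B.length + 8 * L.length + 14

/-- For a small workspace: a block of two digits spends the wire `s` and gains two, without any
tree. The constant 14 in `Stage` is attained here, as 2 · 3 for the flag plus 8 from the two
controlled gates. -/
theorem stage_pair {L W : List Q} {s x y : Q} (h : (L ++ (s :: W ++ [x, y])).Nodup)
    (hlen : L.length ≤ W.length) (E : ℕ) :
    Stage L s W [x, y] E [⟨[x, y], s⟩, ⟨[], x⟩, ⟨[], y⟩]
      (multiControl y (x :: L) (s :: W) ++ multiControl x L (s :: W)) := by
  have hl1 := multiControl_length y (x :: L) (s :: W)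
  have hl2 := multiControl_length x L (s :: W)
  have hy : (y :: (x :: L ++ s :: W)).Nodup := by
    simp [List.nodup_append] at h ⊢
    grind
  have hx : (x :: (L ++ s :: W)).Nodup := by
    simp [List.nodup_append] at h ⊢
    grind
  have hne : x ≠ y ∧ x ≠ s ∧ y ≠ s ∧ x ∉ W ∧ y ∉ W ∧ s ∉ W ∧ y ∉ L := by
    simp [List.nodup_append] at h
    grind
  obtain ⟨hxy, hxs, hys, hxW, hyW, hsW, hyL⟩ := hne
  simp only [List.length_cons] at hl1
  refine ⟨?_, ?_, ?_, ⟨?_, ?_⟩, ⟨3, _, DepthLE.length _, DepthLE.length _, ?_⟩, ?_⟩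
  · refine Valid.cons ?_ (Valid.cons ?_ (Valid.cons ?_ Valid.nil)) <;>
      simp [CX.wires, hxy, hxs.symm, hys.symm]
  · simp [CX.wires]
  · intro σ hs hW
    refine ⟨?_, ?_, fun q hq => ?_⟩
    · simp [run, CX.act, conj, hxs.symm, hys.symm, hs]
    · simp [run, CX.act, conj, hxs, hxy, hys, hxy.symm]
    · have : q ≠ s ∧ q ≠ x ∧ q ≠ y := by grind
      simp [run, CX.act, this, hW q hq]
  · exact (multiControl_valid hy).append (multiControl_valid hx)
  · intro σ _
    rw [run_append, run_multiControl hy (by simp; omega), run_multiControl hx (by simp; omega)]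
    have hL : ∀ v, conj (Function.update σ y v) L = conj σ L := fun v => conj_congr fun q hq => by
      have : q ≠ y := by rintro rfl; exact hyL hq
      simp [this]
    simp only [hL, ripple, conj, Function.update_of_ne hxy]
    have : ∀ a b : Fin 2, a * b = b * a := by decide
    rw [this (σ x)]
  · simp only [List.length_append]
    omega
  · simp only [List.length_append, List.length_cons, List.length_nil]
    omega

/-- The tree takes its `2 * B.length - 2` wires from `W`. The controlled gate borrows `W` as well,
which is harmless since it restores borrowed wires whatever they hold. -/
theorem exists_stage_tree {L W B : List Q} {s : Q} (h : (L ++ (s :: W ++ B)).Nodup)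
    (hlen : L.length ≤ W.length) {E : ℕ} (hE : B.length ≤ 2 ^ E) (hB : B ≠ [])
    (hBW : 2 * B.length ≤ W.length + 2) : ∃ A S, Stage L s W B E A S := by
  have hpos := List.length_pos_iff.2 hB
  obtain ⟨t, rfl, hp, ht⟩ := CarryTree.exists_tree E B (W.take (2 * B.length - 2)) hB hE
    (by rw [List.length_take]; omega)
  have hmem : ∀ q, q ∈ t.ands ∨ q ∈ t.carries → q ∈ W := fun q hq =>
    List.mem_of_mem_take (hp.mem_iff.1 (List.mem_append.2 hq))
  have hnd : (t.ands ++ t.carries).Nodup := by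
    refine hp.nodup_iff.2 (List.Nodup.sublist (List.take_sublist _ _) ?_)
    simp only [List.nodup_append, List.nodup_cons] at h
    exact h.2.1.1.2
  have lay : Layout t s L W := by
    simp only [List.nodup_append, List.nodup_cons, List.mem_append, List.mem_cons] at h hnd
    refine ⟨?_, by grind, by grind, by grind, by grind, ?_, hlen⟩
    · simp only [CarryTree.WF, List.nodup_append, List.mem_append]
      grind
    · simp only [List.nodup_append, List.nodup_cons, List.mem_append]
      grind
  have hl1 := treeFlag_length t s
  have hl2 := treeIncrement_length t s L W
  have hW : s ∉ W ∧ ∀ q ∈ W, q ∉ t.leaves := by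
    simp only [List.nodup_append, List.nodup_cons, List.mem_append, List.mem_cons] at h
    grind
  refine ⟨treeFlag t s, treeIncrement t s L W, treeFlag_valid lay, fun g hg q hq => ?_,
    fun σ hs hσ => ?_, ⟨treeIncrement_valid lay, fun σ hσ => ?_⟩,
    ⟨_, _, treeFlag_depthLE lay.wf, treeIncrement_depthLE lay, by omega⟩, by omega⟩
  · have := treeFlag_wires g hg q hq
    grind
  · have hr := run_treeFlag lay hs fun q hq => hσ q (hmem q (.inl hq))
    refine ⟨?_, fun q hq => ?_, fun q hq => ?_⟩
    · rw [hr, if_pos rfl]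
    · rw [hr, if_neg (by rintro rfl; exact lay.leaves hq), if_pos hq]
    · rw [hr, if_neg (by rintro rfl; exact hW.1 hq), if_neg (hW.2 q hq), hσ q hq]
  · refine run_treeIncrement lay fun h1 => ?_
    have := hσ h1
    simp only [List.mem_cons] at this
    exact ⟨this s (.inl rfl), fun q hq => this q (.inr (hmem q (.inl hq))),
      fun q hq => this q (.inr (hmem q (.inr hq)))⟩

/-- The higher bits are incremented while the flag and the clean block are available. -/
theorem Stage.increments_append {L W B ys : List Q} {s : Q} {E : ℕ} {A S C : List (CX Q)}
    (hS : Stage L s W B E A S) (h : (L ++ (s :: W ++ (B ++ ys))).Nodup)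
    (hC : Increments (s :: L) (W ++ B) ys C) :
    Increments L (s :: W) (B ++ ys) (A ++ (C ++ (A.reverse ++ S))) := by
  refine ⟨hS.valid.append (hC.1.append (hS.valid.reverse.append hS.increments.1)),
    fun σ hσ => ?_⟩
  simp only [List.nodup_append, List.nodup_cons, List.mem_append, List.mem_cons] at h
  have hw := hS.wires
  have hAL : conj (run A σ) L = conj σ L := conj_congr fun q hq =>
    run_apply_of_not_target (q := q)
      (fun g hg e => by have := hw g hg q (by simp [CX.wires, e]); grind -ring) σ
  have hAys : ∀ g ∈ A.reverse, ∀ q ∈ g.wires, q ∉ ys := fun g hg q hq => by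
    have := hw g (by simpa using hg) q hq; grind -ring
  have hflag : conj (run A σ) (s :: L) = conj σ L * conj σ B ∧
      (conj (run A σ) (s :: L) = 1 → ∀ q ∈ W ++ B, run A σ q = 0) := by
    rw [conj, hAL]
    -- If the controls fail, `s` may hold anything after `A`, but the product with the conjunction
    -- of `L` vanishes regardless.
    rcases fin_two_eq_zero_or_one (conj σ L) with hg | hg
    · rw [hg]
      have h0 : ∀ a b : Fin 2, a * 0 = 0 * b := by decide
      have h1 : ∀ a : Fin 2, a * 0 ≠ 1 := by decide
      exact ⟨h0 _ _, fun e => absurd e (h1 _)⟩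
    · have hσ' := hσ hg
      simp only [List.mem_cons] at hσ'
      obtain ⟨f1, f2, f3⟩ := hS.flag σ (hσ' s (.inl rfl)) fun q hq => hσ' q (.inr hq)
      rw [hg, f1]
      have h0 : ∀ a : Fin 2, a * 1 = 1 * a := by decide
      have h1 : ∀ a : Fin 2, a * 1 = a := by decide
      refine ⟨h0 _, fun e q hq => ?_⟩
      rw [h1, conj_eq_one_iff] at e
      rcases List.mem_append.1 hq with hq | hq
      · exact f3 q hq
      · rw [f2 q hq, e q hq]; rfl
  -- `A.reverse` does not touch `ys`, so it commutes with the increment there and cancels against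
  -- `A`.
  rw [run_append, run_append, run_append, hC.2 _ hflag.2, run_ripple hAys,
    run_reverse_run hS.valid, hflag.1, ripple_append (by grind -ring)]
  have hys : ∀ q, q ∉ ys → ∀ g, ripple g ys σ q = σ q := fun q hq g =>
    ripple_apply_of_notMem hq σ
  have hL : conj (ripple (conj σ L * conj σ B) ys σ) L = conj σ L :=
    conj_congr fun q hq => hys q (by grind -ring) _
  rw [hS.increments.2, hL]
  intro e q hq
  rw [hL] at e
  rw [hys q (by grind -ring), hσ e q hq]

theorem increments_nil (L W : List Q) : Increments L W [] [] := ⟨Valid.nil, fun _ _ => rfl⟩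

/-- One stage, given the circuits for the remaining bits. -/
theorem Stage.exists_increments {L W B ys : List Q} {s : Q} {E k : ℕ} {A S : List (CX Q)}
    (hS : Stage L s W B E A S) (h : (L ++ (s :: W ++ (B ++ ys))).Nodup)
    (hC : ∃ C, Increments (s :: L) (W ++ B) ys C ∧
      DepthLE C (k * (12 * E + 8 * (L.length + 1 + k) + 14)) ∧
      C.length ≤ 18 * ys.length + k * (8 * (L.length + 1 + k) + 14)) :
    ∃ C, Increments L (s :: W) (B ++ ys) C ∧
      DepthLE C ((k + 1) * (12 * E + 8 * (L.length + (k + 1)) + 14)) ∧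
      C.length ≤ 18 * (B ++ ys).length + (k + 1) * (8 * (L.length + (k + 1)) + 14) := by
  obtain ⟨C, h1, h2, h3⟩ := hC
  obtain ⟨a, b, ha, hb, hab⟩ := hS.depth
  have hlen := hS.length
  refine ⟨_, hS.increments_append h h1, (ha.seq (h2.seq (ha.reverse.seq hb))).mono ?_, ?_⟩
  · nlinarith
  · simp only [List.length_append, List.length_reverse]
    nlinarith

/-- The last hypothesis says that a workspace growing by 8/7 in each of `k` stages reaches the size
of workspace and register together. The bound on `L.length` guarantees enough borrowed wires; it
persists because a stage adds one control and, if digits remain, at least one clean wire. -/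
theorem exists_increments (E k : ℕ) : ∀ L W xs : List Q, (L ++ (W ++ xs)).Nodup →
    L.length + 1 ≤ W.length → xs.length ≤ 2 ^ E →
    7 ^ k * (W.length + xs.length) ≤ 8 ^ k * W.length →
    ∃ C, Increments L W xs C ∧ DepthLE C (k * (12 * E + 8 * (L.length + k) + 14)) ∧
      C.length ≤ 18 * xs.length + k * (8 * (L.length + k) + 14) := by
  induction k with
  | zero =>
    intro L W xs _ _ _ hk
    obtain rfl : xs = [] := List.length_eq_zero_iff.1 (by omega)
    exact ⟨[], increments_nil L W, DepthLE.nil.mono (by simp), by simp⟩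
  | succ k ih =>
    intro L W xs h hL hE hk
    rcases W with _ | ⟨s, W⟩
    · simp at hL
    simp only [List.length_cons] at hL hk
    -- the circuit for the bits that remain after a block of sufficient size
    have key : ∀ B ys, xs = B ++ ys →
        (ys ≠ [] → 2 ≤ B.length ∧ 8 * (W.length + 1) ≤ 7 * (W.length + B.length)) →
        ∃ C, Increments (s :: L) (W ++ B) ys C ∧
          DepthLE C (k * (12 * E + 8 * (L.length + 1 + k) + 14)) ∧
          C.length ≤ 18 * ys.length + k * (8 * (L.length + 1 + k) + 14) := by
      rintro B ys rfl hB
      by_cases hys : ys = []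
      · subst hys
        exact ⟨[], increments_nil _ _, DepthLE.nil.mono (by simp), by simp⟩
      obtain ⟨hB, hBW⟩ := hB hys
      simp only [List.length_append] at hE hk
      refine ih (s :: L) (W ++ B) ys ?_ ?_ (by omega) ?_
      · simp only [List.nodup_append, List.nodup_cons, List.mem_append, List.mem_cons] at h ⊢
        grind
      · simp only [List.length_cons, List.length_append]; omega
      · simp only [List.length_append]
        have h7 : 7 ^ (k + 1) * (W.length + B.length + ys.length) ≤
            8 ^ k * (7 * (W.length + B.length)) :=
          calc 7 ^ (k + 1) * (W.length + B.length + ys.length)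
              ≤ 7 ^ (k + 1) * (W.length + 1 + (B.length + ys.length)) :=
                Nat.mul_le_mul_left _ (by omega)
            _ ≤ 8 ^ (k + 1) * (W.length + 1) := hk
            _ = 8 ^ k * (8 * (W.length + 1)) := by ring
            _ ≤ _ := Nat.mul_le_mul_left _ hBW
        have e1 : 7 ^ (k + 1) * (W.length + B.length + ys.length) =
          7 * (7 ^ k * (W.length + B.length + ys.length)) := by ring
        have e2 : 8 ^ k * (7 * (W.length + B.length)) = 7 * (8 ^ k * (W.length + B.length)) := by
          ring
        omega
    -- With at most 7 clean wires, a net gain of one is already a factor of 8/7. From 8 on, a block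
    -- of half the workspace gains more than that.
    by_cases hW : W.length + 1 < 8
    · rcases xs with _ | ⟨x, _ | ⟨y, ys⟩⟩
      · exact ⟨[], increments_nil _ _, DepthLE.nil.mono (by simp), by simp⟩
      · have hx : (x :: (L ++ (s :: W))).Nodup := by
          simp only [List.nodup_append, List.nodup_cons, List.mem_append, List.mem_cons] at h ⊢
          grind
        have hl := multiControl_length x L (s :: W)
        have hX : 4 * L.length + 2 ≤ (k + 1) * (8 * (L.length + (k + 1)) + 14) := by nlinarith
        have hX' : (k + 1) * (8 * (L.length + (k + 1)) + 14) ≤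
            (k + 1) * (12 * E + 8 * (L.length + (k + 1)) + 14) :=
          Nat.mul_le_mul_left _ (by omega)
        refine ⟨multiControl x L (s :: W), ⟨multiControl_valid hx, fun σ _ => ?_⟩,
          (DepthLE.length _).mono (by omega), by omega⟩
        rw [run_multiControl hx (by simp; omega)]
        rfl
      · have hp : (L ++ (s :: W ++ [x, y])).Nodup := by
          refine List.Nodup.sublist ?_ h
          simp
        exact (stage_pair hp (by omega) E).exists_increments (ys := ys) h
          (key [x, y] ys rfl fun _ => by simp; omega)
    · by_cases hxs : xs = []
      · subst hxs
        exact ⟨[], increments_nil _ _, DepthLE.nil.mono (by simp), by simp⟩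
      have hpos := List.length_pos_iff.2 hxs
      set m := (W.length + 1) / 2 with hm
      have hB : (xs.take m).length = min m xs.length := List.length_take
      have hxB : xs = xs.take m ++ xs.drop m := (List.take_append_drop _ _).symm
      obtain ⟨A, S, hS⟩ := exists_stage_tree (L := L) (W := W) (B := xs.take m) (s := s)
        (List.Nodup.sublist (by simp [List.take_sublist]) h) (by omega) (E := E) (by omega)
        (by rw [← List.length_pos_iff]; omega) (by omega)
      have := hS.exists_increments (ys := xs.drop m) (by rwa [← hxB])
        (key _ _ hxB fun hne => by
          have := List.length_pos_iff.2 hne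
          rw [List.length_drop] at this
          omega)
      rwa [← hxB] at this

end Stages

/-! ### Realisation by CNOT and single-qubit gates -/

section Quantum

open Matrix

/-- The NOT gate. -/
noncomputable def xGate : unitaryGroup (Fin 2) ℂ :=
  ⟨!![0, 1; 1, 0], by
    rw [mem_unitaryGroup_iff]
    ext i j
    fin_cases i <;> fin_cases j <;> simp [mul_apply, Fin.sum_univ_two, star_apply]⟩

/-- The phase gate. -/
noncomputable def phaseGate (z : Circle) : unitaryGroup (Fin 2) ℂ :=
  ⟨!![1, 0; 0, (z : ℂ)], by
    have : (z : ℂ) * (starRingEnd ℂ) z = 1 := by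
      rw [Complex.mul_conj, Circle.normSq_coe]; simp
    rw [mem_unitaryGroup_iff]
    ext i j
    fin_cases i <;> fin_cases j <;> simp [mul_apply, Fin.sum_univ_two, star_apply, this]⟩

theorem inv_sqrt_two_mul_self : ((√2 : ℝ) : ℂ)⁻¹ * ((√2 : ℝ) : ℂ)⁻¹ = 1 / 2 := by
  rw [← mul_inv, ← Complex.ofReal_mul, Real.mul_self_sqrt (by norm_num)]
  norm_num

/-- The Hadamard gate. -/
noncomputable def hGate : unitaryGroup (Fin 2) ℂ :=
  ⟨!![((√2 : ℝ) : ℂ)⁻¹, ((√2 : ℝ) : ℂ)⁻¹; ((√2 : ℝ) : ℂ)⁻¹, -((√2 : ℝ) : ℂ)⁻¹], by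
    rw [mem_unitaryGroup_iff]
    ext i j
    fin_cases i <;> fin_cases j <;>
      simp [mul_apply, Fin.sum_univ_two, star_apply, Complex.conj_ofReal,
        inv_sqrt_two_mul_self] <;> norm_num⟩

variable {Q : Type} [Fintype Q] [DecidableEq Q]

theorem Circuit.toMatrix_append (A B : Circuit Q) :
    Circuit.toMatrix (A ++ B) = Circuit.toMatrix B * Circuit.toMatrix A := by
  induction A with
  | nil => simp [Circuit.toMatrix]
  | cons g A ih => simp [Circuit.toMatrix, ih, Matrix.mul_assoc]

theorem Gate.single_mulVec (U : unitaryGroup (Fin 2) ℂ) (q : Q) (ψ : State Q) (y : Bits Q) :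
    ((Gate.single U q).toMatrix *ᵥ ψ) y =
      ∑ b, (U : Matrix (Fin 2) (Fin 2) ℂ) (y q) b * ψ (Function.update y q b) := by
  simp only [mulVec, dotProduct, Gate.toMatrix, of_apply, ite_mul, zero_mul]
  rw [← Finset.sum_filter]
  refine Finset.sum_nbij' (fun x => x q) (fun b => Function.update y q b) (by simp) ?_ ?_ ?_ ?_
  · intro b _
    simp +contextual
  · intro x hx
    funext r
    by_cases e : r = q
    · subst e; simp
    · simp [e, (Finset.mem_filter.1 hx).2 r e]
  · simp
  · intro x hx
    congr 2
    funext r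
    by_cases e : r = q
    · subst e; simp
    · simp [e, (Finset.mem_filter.1 hx).2 r e]

theorem Gate.cnot_mulVec {c t : Q} (h : c ≠ t) (ψ : State Q) (y : Bits Q) :
    ((Gate.cnot c t h).toMatrix *ᵥ ψ) y = ψ (Function.update y t (y t + y c)) := by
  have hinv : ∀ x : Bits Q, Function.update (Function.update x t (x t + x c)) t
      (Function.update x t (x t + x c) t + Function.update x t (x t + x c) c) = x := by
    intro x
    simp [h, fin_two_add_add_cancel]
  simp only [mulVec, dotProduct, Gate.toMatrix, of_apply, ite_mul, zero_mul, one_mul]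
  rw [Finset.sum_eq_single (Function.update y t (y t + y c))]
  · rw [if_pos (hinv y).symm]
  · intro x _ hx
    rw [if_neg]
    rintro rfl
    exact hx (hinv x).symm
  · simp

/-- The circuit multiplies the amplitudes by the function `φ`. -/
def IsDiag (C : Circuit Q) (φ : Bits Q → ℂ) : Prop :=
  ∀ ψ y, (C.toMatrix *ᵥ ψ) y = φ y * ψ y

/-- The phase `z` for the bit `1`. -/
noncomputable def phase (z : Circle) (b : Fin 2) : ℂ := if b = 1 then z else 1

theorem isDiag_phaseGate (z : Circle) (q : Q) :
    IsDiag [Gate.single (phaseGate z) q] fun y => phase z (y q) := by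
  intro ψ y
  rw [Circuit.toMatrix, Circuit.toMatrix, Matrix.one_mul, Gate.single_mulVec,
    Fin.sum_univ_two]
  rcases fin_two_eq_zero_or_one (y q) with e | e <;>
  · conv_rhs => rw [← Function.update_eq_self q y]
    simp [e, phaseGate, phase]

theorem IsDiag.append {A B : Circuit Q} {φ χ : Bits Q → ℂ} (hA : IsDiag A φ)
    (hB : IsDiag B χ) : IsDiag (A ++ B) fun y => φ y * χ y := by
  intro ψ y
  rw [Circuit.toMatrix_append, ← mulVec_mulVec, hB, hA]
  ring

theorem IsDiag.cnot_conj {C : Circuit Q} {φ : Bits Q → ℂ} (hC : IsDiag C φ) {c t : Q}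
    (h : c ≠ t) : IsDiag ([Gate.cnot c t h] ++ (C ++ [Gate.cnot c t h]))
      fun y => φ (Function.update y t (y t + y c)) := by
  intro ψ y
  rw [Circuit.toMatrix_append, Circuit.toMatrix_append, Circuit.toMatrix, Circuit.toMatrix,
    Matrix.one_mul, ← mulVec_mulVec, ← mulVec_mulVec, Gate.cnot_mulVec, hC, Gate.cnot_mulVec]
  congr 2
  simp [h, fin_two_add_add_cancel]

/-- The primitive eighth root of unity. -/
noncomputable def zeta : Circle := Circle.exp (Real.pi / 4)

theorem zeta_pow_four : (zeta : ℂ) ^ 4 = -1 := by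
  rw [zeta, Circle.coe_exp, ← Complex.exp_nat_mul, ← Complex.exp_pi_mul_I]
  congr 1
  push_cast
  ring

/-- The doubly controlled sign. -/
noncomputable def ccz {a b t : Q} (hab : a ≠ b) (hat : a ≠ t) (hbt : b ≠ t) : Circuit Q :=
  ([Gate.single (phaseGate zeta) a] ++ ([Gate.single (phaseGate zeta) b] ++
    [Gate.single (phaseGate zeta) t])) ++
  (([Gate.cnot a b hab] ++ ([Gate.single (phaseGate zeta⁻¹) b] ++ [Gate.cnot a b hab])) ++
  (([Gate.cnot a t hat] ++ ([Gate.single (phaseGate zeta⁻¹) t] ++ [Gate.cnot a t hat])) ++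
  ([Gate.cnot b t hbt] ++ (([Gate.single (phaseGate zeta⁻¹) t] ++
    ([Gate.cnot a t hat] ++ ([Gate.single (phaseGate zeta) t] ++ [Gate.cnot a t hat]))) ++
    [Gate.cnot b t hbt]))))

/-- For bits, 4abt = a + b + t − (a⊕b) − (a⊕t) − (b⊕t) + (a⊕b⊕t), and `zeta ^ 4 = -1`. The parities
are produced by conjugating phase gates with CNOTs. -/
theorem isDiag_ccz {a b t : Q} (hab : a ≠ b) (hat : a ≠ t) (hbt : b ≠ t) :
    IsDiag (ccz hab hat hbt) fun y => if y a = 1 ∧ y b = 1 ∧ y t = 1 then -1 else 1 := by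
  have h := ((isDiag_phaseGate zeta a).append ((isDiag_phaseGate zeta b).append
    (isDiag_phaseGate zeta t))).append (((isDiag_phaseGate zeta⁻¹ b).cnot_conj hab).append
    (((isDiag_phaseGate zeta⁻¹ t).cnot_conj hat).append
    (((isDiag_phaseGate zeta⁻¹ t).append ((isDiag_phaseGate zeta t).cnot_conj hat)).cnot_conj
      hbt)))
  intro ψ y
  refine (h ψ y).trans ?_
  congr 1
  simp only [Function.update_self, Function.update_of_ne hat, Circle.coe_inv, phase]
  have hz : (zeta : ℂ) ≠ 0 := Circle.coe_ne_zero _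
  have hz4 := zeta_pow_four
  have h1 : (1 : Fin 2) + 1 = 0 := rfl
  rcases fin_two_eq_zero_or_one (y a) with ea | ea <;>
  rcases fin_two_eq_zero_or_one (y b) with eb | eb <;>
  rcases fin_two_eq_zero_or_one (y t) with et | et <;>
  (simp [ea, eb, et, h1]; try field_simp; try linear_combination hz4)

/-- The Toffoli gate. -/
noncomputable def toffoli {a b t : Q} (hab : a ≠ b) (hat : a ≠ t) (hbt : b ≠ t) : Circuit Q :=
  [Gate.single hGate t] ++ (ccz hab hat hbt ++ [Gate.single hGate t])

theorem toffoli_mulVec {a b t : Q} (hab : a ≠ b) (hat : a ≠ t) (hbt : b ≠ t) (ψ : State Q)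
    (y : Bits Q) : ((toffoli hab hat hbt).toMatrix *ᵥ ψ) y =
      ψ (Function.update y t (y t + y a * y b)) := by
  rw [toffoli, Circuit.toMatrix_append, Circuit.toMatrix_append, Circuit.toMatrix,
    Circuit.toMatrix, Matrix.one_mul, ← mulVec_mulVec, ← mulVec_mulVec, Gate.single_mulVec]
  simp only [isDiag_ccz hab hat hbt _ _, Gate.single_mulVec, Fin.sum_univ_two,
    Function.update_idem, Function.update_self, Function.update_of_ne hat,
    Function.update_of_ne hbt]
  have h2 := inv_sqrt_two_mul_self
  have h1 : (1 : Fin 2) + 1 = 0 := rfl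
  rcases fin_two_eq_zero_or_one (y a) with ea | ea <;>
  rcases fin_two_eq_zero_or_one (y b) with eb | eb <;>
  rcases fin_two_eq_zero_or_one (y t) with et | et <;>
  simp [ea, eb, et, h1, hGate] <;>
  generalize ((√2 : ℝ) : ℂ)⁻¹ = s at h2 ⊢ <;>
  first
    | linear_combination (2 * ψ (Function.update y t 0)) * h2
    | linear_combination (2 * ψ (Function.update y t 1)) * h2

/-- The quantum circuit of a classical gate. -/
noncomputable def CX.toCircuit (g : CX Q) : Circuit Q :=
  match g.controls with
  | [] => [Gate.single xGate g.target]
  | [c] => if h : c ≠ g.target then [Gate.cnot c g.target h] else []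
  | [a, b] =>
    if h : a ≠ b ∧ a ≠ g.target ∧ b ≠ g.target then toffoli h.1 h.2.1 h.2.2 else []
  | _ => []

/-- The quantum circuit of a sequence of classical gates. -/
noncomputable def toCircuit (C : List (CX Q)) : Circuit Q := C.flatMap CX.toCircuit

theorem CX.toCircuit_mulVec {g : CX Q} (h : g.wires.Nodup ∧ g.controls.length ≤ 2)
    (ψ : State Q) (y : Bits Q) : (g.toCircuit.toMatrix *ᵥ ψ) y = ψ (g.act y) := by
  have hm : ∀ a : Fin 2, a * 1 = a := by decide
  obtain ⟨cs, t⟩ := g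
  rcases cs with _ | ⟨a, _ | ⟨b, _ | ⟨c, cs⟩⟩⟩
  · simp only [CX.toCircuit, CX.act, conj]
    rw [Circuit.toMatrix, Circuit.toMatrix, Matrix.one_mul, Gate.single_mulVec,
      Fin.sum_univ_two]
    have h1 : (1 : Fin 2) + 1 = 0 := rfl
    rcases fin_two_eq_zero_or_one (y t) with e | e <;> simp [e, xGate, h1]
  · have hat : a ≠ t := by simp [CX.wires] at h; grind
    simp only [CX.toCircuit, CX.act, conj, hm, dif_pos hat]
    rw [Circuit.toMatrix, Circuit.toMatrix, Matrix.one_mul, Gate.cnot_mulVec]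
  · have hd : a ≠ b ∧ a ≠ t ∧ b ≠ t := by simp [CX.wires] at h; grind
    simp only [CX.toCircuit, CX.act, conj, hm, dif_pos hd]
    rw [toffoli_mulVec]
  · simp at h

/-- The circuit permutes basis states, so the amplitude at `y` comes from the preimage of `y`, which
the reversed circuit computes. -/
theorem toCircuit_mulVec {C : List (CX Q)} (hC : Valid C) (ψ : State Q) (y : Bits Q) :
    ((toCircuit C).toMatrix *ᵥ ψ) y = ψ (run C.reverse y) := by
  induction C generalizing ψ y with
  | nil => simp [toCircuit, Circuit.toMatrix, run]
  | cons g C ih =>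
    rw [toCircuit, List.flatMap_cons, Circuit.toMatrix_append, ← mulVec_mulVec]
    change ((toCircuit C).toMatrix *ᵥ _) y = _
    rw [ih hC.of_cons, CX.toCircuit_mulVec (hC g (by simp)), List.reverse_cons, run_append]
    rfl

theorem CX.toCircuit_support {Q : Type} [DecidableEq Q] (g : CX Q) :
    ∀ g' ∈ g.toCircuit, ∀ q ∈ g'.support, q ∈ g.wires := by
  obtain ⟨cs, t⟩ := g
  rcases cs with _ | ⟨a, _ | ⟨b, _ | ⟨c, cs⟩⟩⟩
  · simp [CX.toCircuit, CX.wires, Gate.support]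
  · by_cases h : a = t <;> simp [CX.toCircuit, CX.wires, Gate.support, h]
  · by_cases h : a ≠ b ∧ a ≠ t ∧ b ≠ t
    · simp only [CX.toCircuit, dif_pos h]
      simp [CX.wires, Gate.support, toffoli, ccz]
    · simp only [CX.toCircuit, dif_neg h]
      simp
  · simp [CX.toCircuit]

/-- The maximum is the Toffoli gate: 15 gates for the doubly controlled sign and two Hadamard gates.
-/
theorem CX.toCircuit_length {Q : Type} [DecidableEq Q] (g : CX Q) : g.toCircuit.length ≤ 17 := by
  obtain ⟨cs, t⟩ := g
  rcases cs with _ | ⟨a, _ | ⟨b, _ | ⟨c, cs⟩⟩⟩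
  · simp [CX.toCircuit]
  · by_cases h : a = t <;> simp [CX.toCircuit, h]
  · by_cases h : a ≠ b ∧ a ≠ t ∧ b ≠ t
    · simp only [CX.toCircuit, dif_pos h]
      simp [toffoli, ccz]
    · simp only [CX.toCircuit, dif_neg h]
      simp
  · simp [CX.toCircuit]

theorem toCircuit_size {Q : Type} [DecidableEq Q] (C : List (CX Q)) : (toCircuit C).size ≤ 17 * C.length := by
  induction C with
  | nil => simp [toCircuit, Circuit.size]
  | cons g C ih =>
    have := g.toCircuit_length
    simp only [toCircuit, Circuit.size, List.flatMap_cons, List.length_append,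
      List.length_cons] at *
    omega

theorem Circuit.depthFrom_le_depth (C : Circuit Q) (q : Q) : C.depthFrom q ≤ C.depth :=
  Finset.le_sup (f := fun q => C.depthFrom q) (Finset.mem_univ q)

theorem Circuit.depthFrom_append_le (A B : Circuit Q) (q : Q) :
    Circuit.depthFrom (A ++ B) q ≤ A.depthFrom q + B.depth := by
  induction A generalizing q with
  | nil => simpa [Circuit.depthFrom] using B.depthFrom_le_depth q
  | cons g A ih =>
    simp only [List.cons_append, Circuit.depthFrom]
    split_ifs with h
    · rw [add_assoc]
      refine Nat.add_le_add_left (Finset.sup_le fun r hr => (ih r).trans ?_) 1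
      exact Nat.add_le_add_right (Finset.le_sup (f := fun r => Circuit.depthFrom A r) hr) _
    · exact ih q

theorem Circuit.depth_append_le (A B : Circuit Q) :
    Circuit.depth (A ++ B) ≤ A.depth + B.depth :=
  Finset.sup_le fun q _ => (Circuit.depthFrom_append_le A B q).trans
    (Nat.add_le_add_right (A.depthFrom_le_depth q) _)

theorem Circuit.depthFrom_eq_zero {Q : Type} [DecidableEq Q] {C : Circuit Q} {q : Q} (h : ∀ g ∈ C, q ∉ g.support) :
    C.depthFrom q = 0 := by
  induction C with
  | nil => rfl
  | cons g C ih =>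
    rw [Circuit.depthFrom, if_neg (h g (by simp)), ih fun g' hg' => h g' (by simp [hg'])]

/-- No directed path passes from `A` to `B`, so from each wire the path length is that in one of the
two circuits alone. -/
theorem Circuit.depth_append_le_of_disjoint {A B : Circuit Q} {d : ℕ} (hA : A.depth ≤ d)
    (hB : B.depth ≤ d) (h : ∀ g ∈ A, ∀ g' ∈ B, ∀ q ∈ g.support, q ∉ g'.support) :
    Circuit.depth (A ++ B) ≤ d := by
  have h1 : ∀ q, (∀ g ∈ B, q ∉ g.support) → Circuit.depthFrom (A ++ B) q = A.depthFrom q := by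
    clear hA
    induction A with
    | nil => exact fun q hq => Circuit.depthFrom_eq_zero hq
    | cons g A ih =>
      intro q hq
      have ih := ih fun g hg => h g (by simp [hg])
      simp only [List.cons_append, Circuit.depthFrom]
      rw [ih q hq, Finset.sup_congr rfl fun r hr => ih r fun g' hg' => h g (by simp) g' hg' r hr]
  have h2 : ∀ q, (∀ g ∈ A, q ∉ g.support) → Circuit.depthFrom (A ++ B) q = B.depthFrom q := by
    clear h1 hA h
    induction A with
    | nil => exact fun q _ => rfl
    | cons g A ih =>
      intro q hq
      rw [List.cons_append, Circuit.depthFrom, if_neg (hq g (by simp)),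
        ih q fun g' hg' => hq g' (by simp [hg'])]
  refine Finset.sup_le fun q _ => ?_
  by_cases hq : ∀ g ∈ A, q ∉ g.support
  · rw [h2 q hq]
    exact (B.depthFrom_le_depth q).trans hB
  · push Not at hq
    obtain ⟨g, hg, hgq⟩ := hq
    rw [h1 q fun g' hg' => h g hg g' hg' q hgq]
    exact (A.depthFrom_le_depth q).trans hA

theorem Circuit.depth_le_length (C : Circuit Q) : C.depth ≤ List.length C := by
  refine Finset.sup_le fun q _ => ?_
  induction C generalizing q with
  | nil => simp [Circuit.depthFrom]
  | cons g C ih =>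
    rw [Circuit.depthFrom, List.length_cons]
    split_ifs
    · rw [add_comm]
      exact Nat.succ_le_succ (Finset.sup_le fun r _ => ih r (Finset.mem_univ r))
    · have := ih q (Finset.mem_univ q)
      omega

theorem DepthLE.depth_le {C : List (CX Q)} {d : ℕ} (h : DepthLE C d) :
    (toCircuit C).depth ≤ 17 * d := by
  induction h with
  | nil => exact Circuit.depth_le_length _
  | gate g =>
    refine (Circuit.depth_le_length _).trans ?_
    simpa [toCircuit] using g.toCircuit_length
  | seq _ _ hA hB =>
    rw [toCircuit, List.flatMap_append]
    refine (Circuit.depth_append_le _ _).trans ?_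
    rw [mul_add]
    exact Nat.add_le_add hA hB
  | par _ _ hd hA hB =>
    rw [toCircuit, List.flatMap_append]
    refine Circuit.depth_append_le_of_disjoint hA hB fun g hg g' hg' q hq hq' => ?_
    obtain ⟨u, hu, hgu⟩ := List.mem_flatMap.1 hg
    obtain ⟨v, hv, hgv⟩ := List.mem_flatMap.1 hg'
    exact hd u hu v hv q (u.toCircuit_support g hgu q hq) (v.toCircuit_support g' hgv q hq')
  | mono _ hab hA => exact hA.trans (Nat.mul_le_mul_left _ hab)

end Quantum

/-! ### From digits to numbers, and the final bounds -/

section Incrementor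

/-- The number with binary digits `xs`, the least significant one first. -/
def number {Q : Type} (σ : Bits Q) : List Q → ℕ
  | [] => 0
  | x :: xs => (σ x : ℕ) + 2 * number σ xs

theorem number_lt {Q : Type} (σ : Bits Q) (xs : List Q) : number σ xs < 2 ^ xs.length := by
  induction xs with
  | nil => simp [number]
  | cons x xs ih =>
    have := (σ x).isLt
    rw [number, List.length_cons, pow_succ]
    omega

theorem number_congr {Q : Type} {σ τ : Bits Q} {xs : List Q} (h : ∀ q ∈ xs, σ q = τ q) :
    number σ xs = number τ xs := by
  induction xs with
  | nil => rfl
  | cons x xs ih => rw [number, number, h x (by simp), ih fun q hq => h q (by simp [hq])]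

theorem eq_of_number_eq {Q : Type} {σ τ : Bits Q} {xs : List Q}
    (h : number σ xs = number τ xs) : ∀ q ∈ xs, σ q = τ q := by
  induction xs with
  | nil => simp
  | cons x xs ih =>
    have h1 := (σ x).isLt
    have h2 := (τ x).isLt
    rw [number, number] at h
    rw [List.forall_mem_cons]
    exact ⟨Fin.ext (by omega), ih (by omega)⟩

/-- Keeping the outgoing carry as a summand gives an exact equation in ℕ, which passes through the
induction; reduction modulo the power of two comes afterwards. -/
theorem number_ripple {Q : Type} [DecidableEq Q] {g : Fin 2} {xs : List Q} (h : xs.Nodup)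
    (σ : Bits Q) : number (ripple g xs σ) xs + 2 ^ xs.length * (g * conj σ xs : Fin 2) =
      number σ xs + g := by
  induction xs generalizing g with
  | nil =>
    simp only [number, conj, List.length_nil]
    revert g; decide
  | cons x xs ih =>
    have hx : x ∉ xs := (List.nodup_cons.1 h).1
    have e : number (ripple g (x :: xs) σ) xs = number (ripple (g * σ x) xs σ) xs :=
      number_congr fun q hq => by
        have : q ≠ x := by rintro rfl; exact hx hq
        simp [ripple, this]
    have hi := ih (g := g * σ x) h.of_cons
    have hm : g * (σ x * conj σ xs) = g * σ x * conj σ xs := by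
      exact (by decide : ∀ a b c : Fin 2, a * (b * c) = a * b * c) _ _ _
    have hv : ripple g (x :: xs) σ x = σ x + g := by simp [ripple]
    have ha : ((σ x + g : Fin 2) : ℕ) + 2 * ((g * σ x : Fin 2) : ℕ) = (σ x : ℕ) + g := by
      exact (by decide : ∀ a b : Fin 2, ((a + b : Fin 2) : ℕ) + 2 * ((b * a : Fin 2) : ℕ) = (a : ℕ) + b)
        _ _
    rw [number, number, conj, e, hv, hm, List.length_cons, pow_succ]
    generalize ((g * σ x * conj σ xs : Fin 2) : ℕ) = c at *
    have : 2 ^ xs.length * 2 * c = 2 * (2 ^ xs.length * c) := by ring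
    omega

theorem number_ripple_one {Q : Type} [DecidableEq Q] {xs : List Q} (h : xs.Nodup)
    (σ : Bits Q) : number (ripple 1 xs σ) xs = (number σ xs + 1) % 2 ^ xs.length := by
  have h1 := number_ripple (g := 1) h σ
  have h2 := number_lt (ripple 1 xs σ) xs
  have h3 : ((1 : Fin 2) : ℕ) = 1 := rfl
  rw [h3] at h1
  rw [← h1, Nat.add_mul_mod_self_left, Nat.mod_eq_of_lt h2]

theorem number_map_finRange {Q : Type} (σ : Bits Q) {n : ℕ} (f : Fin n → Q) :
    number σ ((List.finRange n).map f) = value fun i => σ (f i) := by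
  induction n with
  | zero => simp [number, value]
  | succ n ih =>
    rw [List.finRange_succ, List.map_cons, List.map_map, number, ih]
    simp only [value, Fin.sum_univ_succ, Function.comp, Finset.mul_sum]
    simp only [Fin.val_zero, pow_zero, mul_one, Fin.val_succ, pow_succ]
    congr 1
    refine Finset.sum_congr rfl fun i _ => ?_
    ring

theorem value_injective {n : ℕ} : Function.Injective (value : Bits (Fin n) → ℕ) := by
  intro x y h
  have := number_map_finRange x id
  have hy := number_map_finRange y id
  simp only [List.map_id, id] at this hy
  rw [← this, ← hy] at h
  exact funext fun i => eq_of_number_eq h i (List.mem_finRange i)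

/-- The incrementor moves the amplitude of `x` to the successor of `x`. -/
theorem incrementor_mulVec {n : ℕ} (ψ : State (Fin n)) {x y : Bits (Fin n)}
    (h : value y = (value x + 1) % 2 ^ n) : (incrementor n).mulVec ψ y = ψ x := by
  have hlt : ∀ x : Bits (Fin n), value x < 2 ^ n := fun x => by
    have := number_lt x (List.finRange n)
    have e := number_map_finRange x id
    simp only [List.map_id, id] at e
    rwa [e, List.length_finRange] at this
  simp only [Matrix.mulVec, dotProduct, incrementor, Matrix.of_apply, ite_mul, one_mul, zero_mul]
  rw [Finset.sum_eq_single x]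
  · rw [if_pos h]
  · intro x' _ hx'
    rw [if_neg]
    intro h'
    rw [h] at h'
    refine hx' (value_injective (Nat.ModEq.eq_of_lt_of_lt ?_ (hlt x') (hlt x)))
    exact (Nat.ModEq.add_right_cancel' 1 h').symm
  · simp

/-- A classical circuit which increments the register while the ancilla is clean implements the
incrementor. -/
theorem implements_of_increments {n : ℕ} {C : List (CX (Fin n ⊕ Fin 1))}
    (hC : Increments [] [Sum.inr 0] ((List.finRange n).map Sum.inl) C) :
    (toCircuit C).ImplementsWithCleanAncillas (incrementor n) := by
  intro ψ
  funext z
  rw [toCircuit_mulVec hC.1]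
  set xs : List (Fin n ⊕ Fin 1) := (List.finRange n).map Sum.inl with hxs
  have hnd : xs.Nodup := (List.nodup_finRange n).map Sum.inl_injective
  have hr : ∀ σ : Bits (Fin n ⊕ Fin 1), ∀ a, ripple 1 xs σ (Sum.inr a) = σ (Sum.inr a) :=
    fun σ a => ripple_apply_of_notMem (by simp [hxs]) σ
  have hrun : ∀ σ : Bits (Fin n ⊕ Fin 1), (∀ a, σ (Sum.inr a) = 0) →
      run C σ = ripple 1 xs σ := fun σ hσ => hC.2 σ fun _ q hq => by
    rw [List.mem_singleton.1 hq, hσ 0]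
  have hval : ∀ σ : Bits (Fin n ⊕ Fin 1), value (fun i => ripple 1 xs σ (Sum.inl i)) =
      (value (fun i => σ (Sum.inl i)) + 1) % 2 ^ n := fun σ => by
    have := number_ripple_one hnd σ
    rwa [hxs, number_map_finRange, number_map_finRange, List.length_map, List.length_finRange]
      at this
  have hinv := run_run_reverse hC.1 z
  generalize run C.reverse z = τ at *
  -- the register contents with a clean ancilla are mapped bijectively to each other
  have hsurj : Function.Surjective fun x : Bits (Fin n) =>
      fun i => ripple 1 xs (Sum.elim x fun _ => 0) (Sum.inl i) := by
    refine Finite.injective_iff_surjective.1 fun x y hxy => ?_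
    have e : ripple 1 xs (Sum.elim x fun _ => 0) = ripple 1 xs (Sum.elim y fun _ => 0) := by
      funext q
      rcases q with i | a
      · exact congrFun hxy i
      · rw [hr, hr]; rfl
    rw [← hrun _ fun _ => rfl, ← hrun _ fun _ => rfl] at e
    have e := congrArg (run C.reverse) e
    rw [run_reverse_run hC.1, run_reverse_run hC.1] at e
    exact funext fun i => congrFun e (Sum.inl i)
  unfold withZeros
  by_cases hz : ∀ a, z (Sum.inr a) = 0
  · obtain ⟨x, hx⟩ := hsurj fun i => z (Sum.inl i)
    have hxz : run C (Sum.elim x fun _ => 0) = z := by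
      rw [hrun _ fun _ => rfl]
      funext q
      rcases q with i | a
      · exact congrFun hx i
      · rw [hr, hz]; rfl
    have hτ : τ = Sum.elim x fun _ => 0 := by
      have := congrArg (run C.reverse) (hinv.trans hxz.symm)
      rwa [run_reverse_run hC.1, run_reverse_run hC.1] at this
    rw [if_pos hz, incrementor_mulVec ψ (x := x), hτ]
    · exact if_pos fun _ => rfl
    · have := hval (Sum.elim x fun _ => 0)
      rw [← hrun _ fun _ => rfl, hxz] at this
      exact this
  -- A preimage with clean ancilla would be mapped to a state with clean ancilla, contrary to `hz`.
  · rw [if_neg hz, if_neg]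
    intro hτ
    refine hz fun a => ?_
    rw [← hinv, hrun _ hτ, hr, hτ]

/-- A classical circuit for the incrementor with explicit bounds for depth and size. -/
theorem exists_incrementor_circuit (n : ℕ) : ∃ C : Circuit (Fin n ⊕ Fin 1),
    C.ImplementsWithCleanAncillas (incrementor n) ∧
    C.depth ≤ 8000 * (Nat.log 2 (n + 1) + 1) ^ 2 ∧
    C.size ≤ 306 * n + 8000 * (Nat.log 2 (n + 1) + 1) ^ 2 := by
  set m := Nat.log 2 (n + 1) + 1 with hm
  have hn : n + 1 < 2 ^ m := Nat.lt_pow_succ_log_self (by norm_num) _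
  -- Six stages double the workspace, since 2 · 7⁶ < 8⁶. So `6 * m` stages carry the single ancilla
  -- beyond `n + 1 < 2 ^ m` wires.
  obtain ⟨C, h1, h2, h3⟩ := exists_increments (Q := Fin n ⊕ Fin 1) m (6 * m) [] [Sum.inr 0]
    ((List.finRange n).map Sum.inl)
    (by
      rw [List.nil_append, List.singleton_append, List.nodup_cons]
      exact ⟨by simp, (List.nodup_finRange n).map Sum.inl_injective⟩)
    (by simp) (by simp; omega)
    (by
      simp only [List.length_singleton, List.length_map, List.length_finRange, mul_one]
      calc 7 ^ (6 * m) * (1 + n) ≤ (7 ^ 6) ^ m * 2 ^ m := by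
            rw [pow_mul]; exact Nat.mul_le_mul_left _ (by omega)
        _ = (7 ^ 6 * 2) ^ m := (mul_pow _ _ _).symm
        _ ≤ (8 ^ 6) ^ m := Nat.pow_le_pow_left (by norm_num) m
        _ = 8 ^ (6 * m) := (pow_mul _ _ _).symm)
  have hm1 : 1 ≤ m := by omega
  -- With 17 gates per classical gate, 17 · 6m · (60m + 14) ≤ 8000 m² as m ≥ 1, and 306 = 17 · 18.
  refine ⟨toCircuit C, implements_of_increments h1, h2.depth_le.trans ?_,
    (toCircuit_size C).trans ((Nat.mul_le_mul_left _ h3).trans ?_)⟩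
  · simp only [List.length_nil]
    nlinarith
  · simp only [List.length_nil, List.length_map, List.length_finRange]
    nlinarith

theorem isBigO_log_sq : (fun n : ℕ => ((Nat.log 2 (n + 1) + 1 : ℕ) : ℝ) ^ 2) =O[atTop]
    fun n : ℕ => Real.log (n : ℝ) ^ 2 := by
  refine IsBigO.pow ?_ 2
  -- For n ≥ 3 one has n + 1 ≤ n² and log 2 > 1/2, so the binary logarithm is at most 4 log n; the
  -- summand 1 is at most log n.
  refine IsBigO.of_bound 5 (eventually_atTop.2 ⟨3, fun n hn => ?_⟩)
  have hn' : (3 : ℝ) ≤ n := by exact_mod_cast hn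
  have h1 : (1 : ℝ) ≤ Real.log n := by
    rw [Real.le_log_iff_exp_le (by linarith)]
    exact Real.exp_one_lt_d9.le.trans (by linarith)
  have h2 : (Nat.log 2 (n + 1) : ℝ) ≤ Real.logb 2 ((n + 1 : ℕ) : ℝ) := by
    exact_mod_cast Real.natLog_le_logb (n + 1) 2
  have h3 : Real.log ((n + 1 : ℕ) : ℝ) ≤ 2 * Real.log n := by
    have : Real.log ((n : ℝ) ^ 2) = 2 * Real.log n := by simp
    rw [← this]
    refine Real.log_le_log (by positivity) ?_
    push_cast
    nlinarith
  have h4 : Real.logb 2 ((n + 1 : ℕ) : ℝ) ≤ 4 * Real.log n := by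
    rw [Real.logb, div_le_iff₀ (Real.log_pos (by norm_num))]
    have := Real.log_two_gt_d9
    nlinarith
  rw [Real.norm_of_nonneg (by positivity), Real.norm_of_nonneg (by linarith)]
  push_cast
  linarith

theorem isBigO_log_sq_id : (fun n : ℕ => ((Nat.log 2 (n + 1) + 1 : ℕ) : ℝ) ^ 2) =O[atTop]
    fun n : ℕ => (n : ℝ) := by
  refine isBigO_log_sq.trans ?_
  have := (Real.isLittleO_pow_log_id_atTop (n := 2)).isBigO.comp_tendsto
    (tendsto_natCast_atTop_atTop (R := ℝ))
  exact this

end Incrementor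

end QCircuit

theorem theorem2 :
    ∃ C : (n : ℕ) → QCircuit.Circuit (Fin n ⊕ Fin 1),
      (∀ n, QCircuit.Circuit.ImplementsWithCleanAncillas (C n) (QCircuit.incrementor n)) ∧
      (fun n : ℕ => (QCircuit.Circuit.depth (C n) : ℝ)) =O[atTop]
        (fun n : ℕ => Real.log (n : ℝ) ^ 2) ∧
      (fun n : ℕ => (QCircuit.Circuit.size (C n) : ℝ)) =O[atTop]
        (fun n : ℕ => (n : ℝ)) := by
  choose C h1 h2 h3 using QCircuit.exists_incrementor_circuit
  refine ⟨C, h1, ?_, ?_⟩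
  · refine (IsBigO.of_bound 8000 (Eventually.of_forall fun n => ?_)).trans
      QCircuit.isBigO_log_sq
    rw [Real.norm_of_nonneg (by positivity), Real.norm_of_nonneg (by positivity)]
    exact_mod_cast h2 n
  · refine (IsBigO.of_bound 1 (Eventually.of_forall fun n => ?_)).trans
      (((isBigO_refl _ _).const_mul_left 306).add
        (QCircuit.isBigO_log_sq_id.const_mul_left 8000))
    rw [Real.norm_of_nonneg (by positivity), Real.norm_of_nonneg (by positivity), one_mul]
    exact_mod_cast h3 n
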